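/- **Corollary (trajectory tracking controller).** Let $n\ge 1$ and consider the flexible-joint robot with state $x=(q_\ell,q_m,p_\ell,p_m)\in(\mathbb R^n)^4$ and Hamiltonian $H=\tfrac12p_\ell^\top M_\ell^{-1}(q_\ell)p_\ell+\tfrac12p_m^\top M_m^{-1}(q_m)p_m+P_\ell(q_\ell)+\tfrac12\zeta^\top K\zeta$, $\zeta=q_m-q_\ell$: $$\dot q=\tfrac{\partial H}{\partial p},\qquad \dot p_\ell=-\tfrac{\partial H}{\partial q_\ell}-D_\ell(q_\ell)\tfrac{\partial H}{\partial p_\ell},\qquad \dot p_m=-\tfrac{\partial H}{\partial q_m}-D_m(q_m)\tfrac{\partial H}{\partial p_m}+B_m(q_m)u,$$ where $M_\ell,M_m,K$ are symmetric positive definite, $D_\ell,D_m$ are symmetric positive semidefinite, $B_m$ is invertible, and all data are smooth. For $i\in\{\ell,m\}$ let $S_i(q_i,p_i)$ be smooth and skew-symmetric with $\frac{\partial}{\partial q_i}\big(\tfrac12p_i^\top M_i^{-1}p_i\big)=E_iM_i^{-1}p_i$, where $E_i=S_i-\tfrac12\dot M_i$ and $\dot M_i$ is the derivative along $\dot q_i=M_i^{-1}p_i$.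 The virtual system with state $x_v=(q_{\ell v},q_{mv},p_{\ell v},p_{mv})$, parametrized by $x$, is $$\dot q_{iv}=M_i^{-1}(q_i)p_{iv},\quad \dot p_{\ell v}=-\tfrac{\partial P}{\partial q_\ell}(q_v)-(E_\ell+D_\ell)M_\ell^{-1}p_{\ell v},\quad \dot p_{mv}=-\tfrac{\partial P}{\partial q_m}(q_v)-(E_m+D_m)M_m^{-1}p_{mv}+B_mu,$$ with $P=P_\ell+\tfrac12\zeta^\top K\zeta$ and $E_i,D_i,M_i,B_m$ evaluated at $x$. *Controller.* Let $q_{\ell d}(t)$ be a smooth desired link trajectory, $K_{\ell d},K_{md}$ symmetric positive definite, $\phi_\ell,\phi_m$ smooth maps with $\phi_\ell(0)=\phi_m(0)=0$, and $\Pi_\ell(\tilde q,t),\Pi_m(\tilde q,t)$ smooth symmetric matrices. Put $\tilde q_{\ell v}=q_{\ell v}-q_{\ell d}$, $p_{\ell r}=M_\ell(q_\ell)(\dot q_{\ell d}-\phi_\ell(\tilde q_{\ell v}))$, $\sigma_{\ell v}=p_{\ell v}-p_{\ell r}$, $$u_\ell=\dot p_{\ell r}+\tfrac{\partial P_\ell}{\partial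 q_\ell}(q_{\ell v})+(E_\ell+D_\ell)M_\ell^{-1}p_{\ell r}-\int_0^{\tilde q_{\ell v}}\Pi_\ell\,d\bar q-K_{\ell d}M_\ell^{-1}\sigma_{\ell v},$$ $q_{md}=q_{\ell v}+K^{-1}u_\ell$, $\tilde q_{mv}=q_{mv}-q_{md}$, $p_{mr}=M_m(q_m)\big(\dot q_{md}-\phi_m(\tilde q_{mv})-\Pi_m^{-1}K^\top M_\ell^{-1}\sigma_{\ell v}\big)$, $\sigma_{mv}=p_{mv}-p_{mr}$, and $$u(x_v,x,t)=B_m^{-1}\Big(\dot p_{mr}+K(q_{mv}-q_{\ell v})+(E_m+D_m)M_m^{-1}p_{mr}-\int_0^{\tilde q_{mv}}\Pi_m\,d\bar q-K_{md}M_m^{-1}\sigma_{mv}\Big).$$ The integrals are taken along the straight segment, and dots denote time derivatives along the robot and virtual system (none of the differentiated quantities depends on $p_m$ or $p_{mv}$, so their derivatives are functions of $(x_v,x,t)$ not involving the input). *Assumptions.* For all $x_v,x$ and $t\ge0$, and $i\in\{\ell,m\}$, $$\dot\Pi_i(\tilde q_{iv},t)-\Pi_i\tfrac{\partial\phi_i}{\partial\tilde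 q_{iv}}-\tfrac{\partial\phi_i}{\partial\tilde q_{iv}}^{\!\top}\Pi_i\le-2\beta_i(\tilde q_{iv},t)\,\Pi_i,$$ where $\beta_\ell,\beta_m$ are bounded below by a positive constant for $t\ge 0$; and there are constants $0<c_1\le c_2$ with $c_1I\le\Pi_\ell,\Pi_m,M_\ell^{-1},M_m^{-1}\le c_2I$ for all arguments with $t\ge0$. *Conclusion.* With $D=\mathrm{diag}(D_\ell,D_m)$, $K_d=\mathrm{diag}(K_{\ell d},K_{md})$, $M=\mathrm{diag}(M_\ell,M_m)$, let $$\beta=\min\{\min\{\beta_\ell,\beta_m\},\ \lambda_{\min}\{D+K_d\}\,\lambda_{\min}\{M^{-1}\}\},$$ where $\beta_\ell,\beta_m$ stand for their infima over $(\tilde q,t)$, $t\ge0$, and the smallest eigenvalues for their infima over $q$. Then $\beta>0$. Close the loop with $u=u(x,x,t)$, and consider solutions $x$ on any interval $J\subseteq[t_0,\infty)$ with $t_0\in J$, $t_0\ge0$. Write $\tilde x=(\tilde q_\ell,\tilde q_m,\sigma_\ell,\sigma_m)$ for the errors at $x_v=x$, and $q_d=(q_{\ell d},q_{md})$ with $q_{md},\dot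 q_{md}$ evaluated at $x_v=x(t)$. 1. There is $C$, independent of the solution, of $J$ and of $t_0$, with $\|\tilde x(t)\|\le Ce^{-\beta(t-t_0)}\|\tilde x(t_0)\|$ for $t\in J$. 2. For all $t_0\ge 0$ and $x_0$ there is $C$ such that every solution with $x(t_0)=x_0$, on any such $J$, satisfies $\|x(t)-(q_d,\,M(q(t))\dot q_d)\|\le Ce^{-\beta(t-t_0)}$ for $t\in J$. 3. If moreover $q_{\ell d},\dot q_{\ell d},\ddot q_{\ell d},\dddot q_{\ell d}$ are bounded on $[0,\infty)$ and $\partial\Pi_\ell/\partial t$ is bounded for $t\ge0$, then for all $t_0\ge 0$ and $x_0$ there is $C$ such that every solution with $x(t_0)=x_0$, on any such $J$, converges exponentially to the desired trajectory $x_d=(q_d,\,M(q_d)\dot q_d)$: $\|x(t)-x_d(t)\|\le Ce^{-\beta(t-t_0)}$ for $t\in J$. -/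

import Mathlib

open scoped ContDiff Gradient RealInnerProductSpace NNReal

noncomputable section

namespace FlexibleJoint

/-- Coordinate space `ℝⁿ`. Square matrices are treated as linear operators on it. -/
abbrev Vec (n : ℕ) : Type := EuclideanSpace ℝ (Fin n)

/-- Square matrices of size `n`. -/
abbrev Mat (n : ℕ) : Type := Vec n →L[ℝ] Vec n

/-- Phase states `x = ((q_ℓ, q_m), (p_ℓ, p_m))`. -/
abbrev State (n : ℕ) : Type := (Vec n × Vec n) × (Vec n × Vec n)

section Projections
variable {n : ℕ}

/-- Link positions. -/
def ql (x : State n) : Vec n := x.1.1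
/-- Motor positions. -/
def qm (x : State n) : Vec n := x.1.2
/-- Link momenta. -/
def pl (x : State n) : Vec n := x.2.1
/-- Motor momenta. -/
def pm (x : State n) : Vec n := x.2.2

/-- Symmetric positive definite. -/
def PosDef (A : Mat n) : Prop := IsSelfAdjoint A ∧ ∀ v : Vec n, v ≠ 0 → 0 < ⟪v, A v⟫

/-- Symmetric positive semidefinite. -/
def PosSemidef (A : Mat n) : Prop := IsSelfAdjoint A ∧ ∀ v : Vec n, 0 ≤ ⟪v, A v⟫

/-- The time derivative `Ṁ(q)` of an inertia matrix at the phase point `(q, p)`, i.e. along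
`q̇ = M(q)⁻¹ p`. -/
def inertiaRate (M : Vec n → Mat n) (q p : Vec n) : Mat n :=
  fderiv ℝ M q ((M q).inverse p)

/-- `S(q,p)` is a matrix of gyroscopic forces for the inertia matrix `M`: it is skew-symmetric and
`∂/∂q (½ pᵀ M(q)⁻¹ p) = [S(q,p) - ½ Ṁ(q)] M(q)⁻¹ p`. (Such an `S` exists but is not unique.) -/
def IsGyroscopic (M : Vec n → Mat n) (S : Vec n → Vec n → Mat n) : Prop :=
  (∀ q p, ContinuousLinearMap.adjoint (S q p) = -S q p) ∧
  ∀ q p, ∇ (fun y : Vec n => (1 / 2 : ℝ) * ⟪p, (M y).inverse p⟫) q =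
    (S q p - (1 / 2 : ℝ) • inertiaRate M q p) ((M q).inverse p)

end Projections

/-- A flexible-joint robot with `n` links and `n` motors: inertia matrices `Ml, Mm`, damping
matrices `Dl, Dm`, link potential energy `Pl`, stiffness `K`, motor input matrix `Bm`, together
with a choice of gyroscopic matrices `Sl, Sm`. -/
structure Robot (n : ℕ) where
  Ml : Vec n → Mat n
  Mm : Vec n → Mat n
  Dl : Vec n → Mat n
  Dm : Vec n → Mat n
  Pl : Vec n → ℝ
  K : Mat n
  Bm : Vec n → Mat n
  Sl : Vec n → Vec n → Mat n
  Sm : Vec n → Vec n → Mat n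
  smooth_Ml : ContDiff ℝ ∞ Ml
  smooth_Mm : ContDiff ℝ ∞ Mm
  smooth_Dl : ContDiff ℝ ∞ Dl
  smooth_Dm : ContDiff ℝ ∞ Dm
  smooth_Pl : ContDiff ℝ ∞ Pl
  smooth_Bm : ContDiff ℝ ∞ Bm
  smooth_Sl : ContDiff ℝ ∞ (fun z : Vec n × Vec n => Sl z.1 z.2)
  smooth_Sm : ContDiff ℝ ∞ (fun z : Vec n × Vec n => Sm z.1 z.2)
  posDef_Ml : ∀ q, PosDef (Ml q)
  posDef_Mm : ∀ q, PosDef (Mm q)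
  posSemidef_Dl : ∀ q, PosSemidef (Dl q)
  posSemidef_Dm : ∀ q, PosSemidef (Dm q)
  posDef_K : PosDef K
  isUnit_Bm : ∀ q, IsUnit (Bm q)
  gyroscopic_Sl : IsGyroscopic Ml Sl
  gyroscopic_Sm : IsGyroscopic Mm Sm

namespace Robot
variable {n : ℕ} (R : Robot n)

/-- Inverse link inertia. -/
def MlInv (q : Vec n) : Mat n := (R.Ml q).inverse
/-- Inverse motor inertia. -/
def MmInv (q : Vec n) : Mat n := (R.Mm q).inverse

/-- Potential energy `P(q) = P_ℓ(q_ℓ) + ½ ζᵀ K ζ`, `ζ = q_m - q_ℓ`. -/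
def potential (q : Vec n × Vec n) : ℝ :=
  R.Pl q.1 + (1 / 2 : ℝ) * ⟪q.2 - q.1, R.K (q.2 - q.1)⟫

/-- Virtual Hamiltonian `H_v(x_v, x) = ½ p_vᵀ M(q)⁻¹ p_v + P(q_v)`. -/
def virtualHamiltonian (xv x : State n) : ℝ :=
  (1 / 2 : ℝ) * ⟪pl xv, R.MlInv (ql x) (pl xv)⟫ + (1 / 2 : ℝ) * ⟪pm xv, R.MmInv (qm x) (pm xv)⟫
    + R.potential (ql xv, qm xv)

/-- Total energy `H(x) = ½ pᵀ M(q)⁻¹ p + P(q)`. -/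
def hamiltonian (x : State n) : ℝ :=
  (1 / 2 : ℝ) * ⟪pl x, R.MlInv (ql x) (pl x)⟫ + (1 / 2 : ℝ) * ⟪pm x, R.MmInv (qm x) (pm x)⟫
    + R.potential (ql x, qm x)

/-- Workless-forces matrix of the links, `E_ℓ = S_ℓ - ½ Ṁ_ℓ`. -/
def El (x : State n) : Mat n :=
  R.Sl (ql x) (pl x) - (1 / 2 : ℝ) • inertiaRate R.Ml (ql x) (pl x)

/-- Workless-forces matrix of the motors, `E_m = S_m - ½ Ṁ_m`. -/
def Em (x : State n) : Mat n :=
  R.Sm (qm x) (pm x) - (1 / 2 : ℝ) • inertiaRate R.Mm (qm x) (pm x)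

/-- The port-Hamiltonian vector field of the robot with input `u`:
`q̇ = ∂H/∂p`, `ṗ_ℓ = -∂H/∂q_ℓ - D_ℓ ∂H/∂p_ℓ`, `ṗ_m = -∂H/∂q_m - D_m ∂H/∂p_m + B_m u`. -/
def field (x : State n) (u : Vec n) : State n :=
  let dHql := ∇ (fun y => R.hamiltonian ((y, qm x), (pl x, pm x))) (ql x)
  let dHqm := ∇ (fun y => R.hamiltonian ((ql x, y), (pl x, pm x))) (qm x)
  let dHpl := ∇ (fun y => R.hamiltonian ((ql x, qm x), (y, pm x))) (pl x)
  let dHpm := ∇ (fun y => R.hamiltonian ((ql x, qm x), (pl x, y))) (pm x)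
  ((dHpl, dHpm),
    (-dHql - R.Dl (ql x) dHpl, -dHqm - R.Dm (qm x) dHpm + R.Bm (qm x) u))

/-- The vector field of the virtual system, with state `xv`, parametrized by `x`, with input `u`:
`q̇_v = ∂H_v/∂p_v`, `ṗ_v = -∂H_v/∂q_v - (E(x) + D(q)) ∂H_v/∂p_v + (0, B_m(q_m) u)`. -/
def virtualField (xv x : State n) (u : Vec n) : State n :=
  let dHql := ∇ (fun y => R.virtualHamiltonian ((y, qm xv), (pl xv, pm xv)) x) (ql xv)
  let dHqm := ∇ (fun y => R.virtualHamiltonian ((ql xv, y), (pl xv, pm xv)) x) (qm xv)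
  let dHpl := ∇ (fun y => R.virtualHamiltonian ((ql xv, qm xv), (y, pm xv)) x) (pl xv)
  let dHpm := ∇ (fun y => R.virtualHamiltonian ((ql xv, qm xv), (pl xv, y)) x) (pm xv)
  ((dHpl, dHpm),
    (-dHql - (R.El x + R.Dl (ql x)) dHpl,
      -dHqm - (R.Em x + R.Dm (qm x)) dHpm + R.Bm (qm x) u))

/-- Time derivative of a quantity `g(x_v, x, t)` along the robot and its virtual system. It is only
applied to quantities that do not depend on the motor momenta `p_m`, `p_mv`; as the input enters
the `p_m` and `p_mv` equations only, it plays no role and is set to zero. -/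
def totalDeriv {F : Type*} [NormedAddCommGroup F] [NormedSpace ℝ F]
    (g : State n → State n → ℝ → F) (xv x : State n) (t : ℝ) : F :=
  fderiv ℝ (fun y : State n × State n × ℝ => g y.1 y.2.1 y.2.2) (xv, x, t)
    (R.virtualField xv x 0, R.field x 0, 1)

end Robot

/-- Design data of the tracking controller: desired link trajectory `qld`, the maps `φ_ℓ, φ_m`, the
metrics `Π_ℓ(q̃,t), Π_m(q̃,t)`, the gains `K_ℓd, K_md` and the decay functions `β_ℓ, β_m`. The
conditions on them are collected in `Design.Admissible`. -/
structure Design (n : ℕ) where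
  qld : ℝ → Vec n
  φl : Vec n → Vec n
  φm : Vec n → Vec n
  PiL : Vec n → ℝ → Mat n
  PiM : Vec n → ℝ → Mat n
  Kld : Mat n
  Kmd : Mat n
  βl : Vec n → ℝ → ℝ
  βm : Vec n → ℝ → ℝ

/-- The line integral `∫₀^z Π(y,t) dy`, along the segment from `0` to `z`. -/
def metricIntegral {n : ℕ} (P : Vec n → ℝ → Mat n) (z : Vec n) (t : ℝ) : Vec n :=
  ∫ s in (0 : ℝ)..1, P (s • z) t z

namespace Design
variable {n : ℕ} (d : Design n) (R : Robot n)

/-- Link position error `q̃_ℓv = q_ℓv - q_ℓd`. -/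
def errL (xv _x : State n) (t : ℝ) : Vec n := ql xv - d.qld t

/-- Auxiliary link momentum reference `p_ℓr = M_ℓ(q_ℓ)(q̇_ℓd - φ_ℓ(q̃_ℓv))`. -/
def plr (xv x : State n) (t : ℝ) : Vec n :=
  R.Ml (ql x) (deriv d.qld t - d.φl (d.errL xv x t))

/-- Link momentum error `σ_ℓv = p_ℓv - p_ℓr`. -/
def sigmaL (xv x : State n) (t : ℝ) : Vec n := pl xv - d.plr R xv x t

/-- Link control law `u_ℓ(x_ℓv, x_ℓ, t)`. -/
def ul (xv x : State n) (t : ℝ) : Vec n :=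
  R.totalDeriv (d.plr R) xv x t + ∇ R.Pl (ql xv)
    + (R.El x + R.Dl (ql x)) (R.MlInv (ql x) (d.plr R xv x t))
    - metricIntegral d.PiL (d.errL xv x t) t
    - d.Kld (R.MlInv (ql x) (d.sigmaL R xv x t))

/-- Motor position reference `q_md = q_ℓv + K⁻¹ u_ℓ` (on the actual system, where `x_v = x`, this is
`q_ℓ + K⁻¹ u_ℓ`). -/
def qmd (xv x : State n) (t : ℝ) : Vec n := ql xv + R.K.inverse (d.ul R xv x t)

/-- Motor position error `q̃_mv = q_mv - q_md`. -/
def errM (xv x : State n) (t : ℝ) : Vec n := qm xv - d.qmd R xv x t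

/-- Auxiliary motor momentum reference
`p_mr = M_m(q_m)(q̇_md - φ_m(q̃_mv) - Π_m⁻¹ Kᵀ M_ℓ⁻¹ σ_ℓv)`. -/
def pmr (xv x : State n) (t : ℝ) : Vec n :=
  R.Mm (qm x) (R.totalDeriv (d.qmd R) xv x t - d.φm (d.errM R xv x t)
    - (d.PiM (d.errM R xv x t) t).inverse
        (ContinuousLinearMap.adjoint R.K (R.MlInv (ql x) (d.sigmaL R xv x t))))

/-- Motor momentum error `σ_mv = p_mv - p_mr`. -/
def sigmaM (xv x : State n) (t : ℝ) : Vec n := pm xv - d.pmr R xv x t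

/-- The virtual control law `u(x_v, x, t)`, with external input `ω = 0`. -/
def control (xv x : State n) (t : ℝ) : Vec n :=
  (R.Bm (qm x)).inverse
    (R.totalDeriv (d.pmr R) xv x t + R.K (qm xv - ql xv)
      + (R.Em x + R.Dm (qm x)) (R.MmInv (qm x) (d.pmr R xv x t))
      - metricIntegral d.PiM (d.errM R xv x t) t
      - d.Kmd (R.MmInv (qm x) (d.sigmaM R xv x t)))

/-- The matrix inequality `Π̇ - Π ∂φ/∂q̃ - (∂φ/∂q̃)ᵀ Π ≤ -2 β Π` for the metric `Π(q̃,t)`, where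
`q̃ = err x_v x t` and `Π̇` is the time derivative of `Π(q̃,t)`. -/
def MetricInequality (err : State n → State n → ℝ → Vec n) (P : Vec n → ℝ → Mat n)
    (φ : Vec n → Vec n) (β : Vec n → ℝ → ℝ) : Prop :=
  ∀ xv x : State n, ∀ t : ℝ, 0 ≤ t → ∀ v : Vec n,
    let z := err xv x t
    ⟪v, (R.totalDeriv (fun yv y s => P (err yv y s) s) xv x t
          - P z t ∘L fderiv ℝ φ z
          - ContinuousLinearMap.adjoint (fderiv ℝ φ z) ∘L P z t) v⟫
      ≤ -2 * β z t * ⟪v, P z t v⟫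

/-- The conditions on the design data. -/
structure Admissible : Prop where
  smooth_qld : ContDiff ℝ ∞ d.qld
  smooth_φl : ContDiff ℝ ∞ d.φl
  smooth_φm : ContDiff ℝ ∞ d.φm
  smooth_PiL : ContDiff ℝ ∞ (fun z : Vec n × ℝ => d.PiL z.1 z.2)
  smooth_PiM : ContDiff ℝ ∞ (fun z : Vec n × ℝ => d.PiM z.1 z.2)
  φl_zero : d.φl 0 = 0
  φm_zero : d.φm 0 = 0
  selfAdjoint_PiL : ∀ z t, 0 ≤ t → IsSelfAdjoint (d.PiL z t)
  selfAdjoint_PiM : ∀ z t, 0 ≤ t → IsSelfAdjoint (d.PiM z t)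
  /-- The metric `diag(Π_ℓ, Π_m, M_ℓ⁻¹, M_m⁻¹)` of the storage function is uniformly equivalent to
  the Euclidean one. -/
  uniform_metric : ∃ c₁ c₂ : ℝ, 0 < c₁ ∧ ∀ v : Vec n,
    (∀ z t, 0 ≤ t → c₁ * ‖v‖ ^ 2 ≤ ⟪v, d.PiL z t v⟫ ∧ ⟪v, d.PiL z t v⟫ ≤ c₂ * ‖v‖ ^ 2) ∧
    (∀ z t, 0 ≤ t → c₁ * ‖v‖ ^ 2 ≤ ⟪v, d.PiM z t v⟫ ∧ ⟪v, d.PiM z t v⟫ ≤ c₂ * ‖v‖ ^ 2) ∧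
    (∀ q, c₁ * ‖v‖ ^ 2 ≤ ⟪v, R.MlInv q v⟫ ∧ ⟪v, R.MlInv q v⟫ ≤ c₂ * ‖v‖ ^ 2) ∧
    (∀ q, c₁ * ‖v‖ ^ 2 ≤ ⟪v, R.MmInv q v⟫ ∧ ⟪v, R.MmInv q v⟫ ≤ c₂ * ‖v‖ ^ 2)
  posDef_Kld : PosDef d.Kld
  posDef_Kmd : PosDef d.Kmd
  uniform_βl : ∃ b : ℝ, 0 < b ∧ ∀ z t, 0 ≤ t → b ≤ d.βl z t
  uniform_βm : ∃ b : ℝ, 0 < b ∧ ∀ z t, 0 ≤ t → b ≤ d.βm z t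
  metric_ineq_l : MetricInequality R d.errL d.PiL d.φl d.βl
  metric_ineq_m : MetricInequality R (d.errM R) d.PiM d.φm d.βm

/-- Smallest eigenvalue of a linear operator with real spectrum. -/
def lambdaMin {V : Type*} [AddCommGroup V] [Module ℝ V] (A : V →ₗ[ℝ] V) : ℝ :=
  sInf {μ : ℝ | Module.End.HasEigenvalue A μ}

/-- `λ_min{D + K_d}`, with `D = diag(D_ℓ, D_m)` and `K_d = diag(K_ℓd, K_md)`, uniformly over the
configurations `q = (q_ℓ, q_m)`. -/
def lambdaDamping : ℝ :=
  ⨅ q : Vec n × Vec n, lambdaMin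
    (((R.Dl q.1 + d.Kld).prodMap (R.Dm q.2 + d.Kmd)).toLinearMap)

/-- `λ_min{M⁻¹}`, with `M = diag(M_ℓ, M_m)`, uniformly over the configurations
`q = (q_ℓ, q_m)`. -/
def lambdaInvInertia : ℝ :=
  ⨅ q : Vec n × Vec n, lambdaMin (((R.MlInv q.1).prodMap (R.MmInv q.2)).toLinearMap)

/-- The rate `β = min{min{β_ℓ, β_m}, λ_min{D + K_d} λ_min{M⁻¹}}`, where `β_ℓ` and `β_m` are taken
uniformly over errors and times `t ≥ 0`. -/
def rate : ℝ :=
  min (min (⨅ z : Vec n × ℝ≥0, d.βl z.1 z.2) (⨅ z : Vec n × ℝ≥0, d.βm z.1 z.2))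
    (d.lambdaDamping R * lambdaInvInertia R)

/-- `x` is a solution, on the time interval `J`, of the robot in closed loop with
`u(x, x, t)`. -/
def IsClosedLoopSolution (J : Set ℝ) (x : ℝ → State n) : Prop :=
  ∀ t ∈ J, HasDerivWithinAt x (R.field (x t) (d.control R (x t) (x t) t)) J t

/-- The error `x̃ = ((q̃_ℓ, q̃_m), (σ_ℓ, σ_m))` of the actual state. -/
def error (x : State n) (t : ℝ) : State n :=
  ((d.errL x x t, d.errM R x x t), (d.sigmaL R x x t, d.sigmaM R x x t))

/-- Desired positions `q_d = (q_ℓd, q_md)` (the motor reference depends on the actual state). -/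
def qDesired (x : State n) (t : ℝ) : Vec n × Vec n := (d.qld t, d.qmd R x x t)

/-- Desired velocities `q̇_d = (q̇_ℓd, q̇_md)`. -/
def vDesired (x : State n) (t : ℝ) : Vec n × Vec n :=
  (deriv d.qld t, R.totalDeriv (d.qmd R) x x t)

/-- The desired trajectory `x_d = (q_d, M(q_d) q̇_d)`. -/
def xDesired (x : State n) (t : ℝ) : State n :=
  (d.qDesired R x t,
    (R.Ml (d.qDesired R x t).1 (d.vDesired R x t).1,
      R.Mm (d.qDesired R x t).2 (d.vDesired R x t).2))

/-- The desired steady state `(q_d, M(q) q̇_d)` of the virtual system along the robot trajectory. -/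
def xSteady (x : State n) (t : ℝ) : State n :=
  (d.qDesired R x t,
    (R.Ml (ql x) (d.vDesired R x t).1, R.Mm (qm x) (d.vDesired R x t).2))

/-- The desired link trajectory is bounded with its derivatives up to order three, and the
explicit time dependence of the link metric has bounded derivative. -/
def BoundedReference : Prop :=
  ∃ b : ℝ, ∀ t : ℝ, 0 ≤ t →
    (∀ k : ℕ, k ≤ 3 → ‖iteratedDeriv k d.qld t‖ ≤ b) ∧
    ∀ z : Vec n, ‖deriv (fun s => d.PiL z s) t‖ ≤ b

end Design

end FlexibleJoint

end

/-!
The matrix inequality for a metric `Π(q̃, t)` is required at every virtual state. The velocity of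
`q̃` is an arbitrary vector there, because the virtual momentum is free, while the right hand side
does not involve it. A linear function of the velocity that is bounded above vanishes, so for
`t ≥ 0` the metrics `Π_ℓ`, `Π_m` depend on time only (`FreeMetricInequality.eq_zero_pos`), and the
control terms `∫₀^q̃ Π` are linear, `Π(t) q̃`. Integrating the matrix inequality along the segment
from `0` to `q̃` turns it into decay of `q̃ᵀ Π(t) q̃` along `dq̃/dt = -φ(q̃)`
(`FreeMetricInequality.integrated`).

By the gyroscopic identity the robot is its virtual system at `x_v = x` (`Robot.field_eq`). The
references `p_ℓr`, `q_md`, `p_mr` do not involve the motor momenta, so their total derivatives are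
their time derivatives along the closed loop (`DependsOn.hasDerivWithinAt`), and the error obeys,
with `w_i = M_i⁻¹ σ_i`,

* `dq̃_ℓ/dt = w_ℓ - φ_ℓ(q̃_ℓ)`,
* `dσ_ℓ/dt = K q̃_m - (E_ℓ + D_ℓ + K_ℓd) w_ℓ - Π_ℓ q̃_ℓ`,
* `dq̃_m/dt = w_m - φ_m(q̃_m) - Π_m⁻¹ Kᵀ w_ℓ`,
* `dσ_m/dt = -(E_m + D_m + K_md) w_m - Π_m q̃_m`.

In the derivative of `V = x̃ᵀ diag(Π_ℓ, Π_m, M_ℓ⁻¹, M_m⁻¹) x̃` the skew-symmetric forces and the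
inertia rates drop out and the coupling terms cancel in pairs, which leaves `dV/dt ≤ -2 β V`
(`Design.Admissible.exists_hasDerivWithinAt_storage`). As `V` is uniformly equivalent to `‖x̃‖²`,
the error decays at the rate `β`.

The distance to the steady state is at most a multiple of the error, since `φ_ℓ`, `φ_m` vanish at
zero and are Lipschitz on bounded sets. For the desired trajectory one compares `M(q)` with
`M(q_d)`, which needs bounds for `q`, `q_md` and `dq_md/dt`; they follow from the bounded reference
because `u_ℓ` at `x_v = x` is a smooth function of the link state and of the reference, up to the
term `Π_ℓ(t) q̃_ℓ` (`Design.Admissible.exists_bounds`).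
-/

noncomputable section

namespace FlexibleJoint

/-! ### Smooth dependence of integrals on parameters -/

lemma hasFDerivAt_intervalIntegral {E F : Type} [NormedAddCommGroup E] [NormedSpace ℝ E]
    [FiniteDimensional ℝ E] [NormedAddCommGroup F] [NormedSpace ℝ F] [CompleteSpace F]
    {f : E → ℝ → F} (hf : ContDiff ℝ 1 (fun z : E × ℝ => f z.1 z.2)) (x : E) :
    HasFDerivAt (fun y => ∫ s in (0 : ℝ)..1, f y s)
      (∫ s in (0 : ℝ)..1, fderiv ℝ (fun y => f y s) x) x := by
  have hproper : ProperSpace E := FiniteDimensional.proper ℝ E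
  have hd : ∀ y s, HasFDerivAt (fun y => f y s)
      ((fderiv ℝ (fun z : E × ℝ => f z.1 z.2) (y, s)).comp
        ((ContinuousLinearMap.id ℝ E).prod 0)) y := by
    intro y s
    have h1 := (hf.differentiable one_ne_zero (y, s)).hasFDerivAt
    have h2 : HasFDerivAt (fun y : E => (y, s)) ((ContinuousLinearMap.id ℝ E).prod 0) y :=
      (hasFDerivAt_id y).prodMk (hasFDerivAt_const s y)
    exact HasFDerivAt.comp y h1 h2
  have hcont : Continuous (fun z : E × ℝ => fderiv ℝ (fun y => f y z.2) z.1) := by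
    have h1 : Continuous (fun z : E × ℝ => fderiv ℝ (fun z : E × ℝ => f z.1 z.2) z) :=
      hf.continuous_fderiv one_ne_zero
    have h2 : (fun z : E × ℝ => fderiv ℝ (fun y => f y z.2) z.1) =
      fun z => (fderiv ℝ (fun z : E × ℝ => f z.1 z.2) z).comp
        ((ContinuousLinearMap.id ℝ E).prod 0) := funext fun z => (hd z.1 z.2).fderiv
    rw [h2]
    exact h1.clm_comp continuous_const
  obtain ⟨C, hC⟩ := ((isCompact_closedBall x 1).prod (isCompact_Icc (a := (0 : ℝ)) (b := 1))
    ).exists_bound_of_continuousOn hcont.continuousOn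
  have hfc : Continuous (fun z : E × ℝ => f z.1 z.2) := hf.continuous
  refine intervalIntegral.hasFDerivAt_integral_of_dominated_of_fderiv_le
    (F := fun y s => f y s) (F' := fun y s => fderiv ℝ (fun y => f y s) y)
    (bound := fun _ => C) (Metric.closedBall_mem_nhds x one_pos) ?_ ?_ ?_ ?_ ?_ ?_
  · refine Filter.Eventually.of_forall fun y => ?_
    exact (hfc.comp (by fun_prop : Continuous fun s : ℝ => (y, s))).aestronglyMeasurable
  · exact (hfc.comp (by fun_prop : Continuous fun s : ℝ => (x, s))).intervalIntegrable _ _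
  · exact (hcont.comp (by fun_prop : Continuous fun s : ℝ => (x, s))).aestronglyMeasurable
  · refine Filter.Eventually.of_forall fun s hs y hy => ?_
    rw [Set.uIoc_of_le zero_le_one] at hs
    exact hC (y, s) ⟨hy, ⟨hs.1.le, hs.2⟩⟩
  · exact intervalIntegrable_const
  · exact Filter.Eventually.of_forall fun s _ y _ => (hd y s).differentiableAt.hasFDerivAt

lemma contDiff_intervalIntegral_nat {E : Type} [NormedAddCommGroup E] [NormedSpace ℝ E]
    [FiniteDimensional ℝ E] (k : ℕ) : ∀ {F : Type} [NormedAddCommGroup F] [NormedSpace ℝ F]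
    [CompleteSpace F] {f : E → ℝ → F}, ContDiff ℝ ∞ (fun z : E × ℝ => f z.1 z.2) →
    ContDiff ℝ k (fun y => ∫ s in (0 : ℝ)..1, f y s) := by
  induction k with
  | zero =>
    intro F _ _ _ f hf
    refine contDiff_zero.2 (continuous_iff_continuousAt.2 fun x => ?_)
    exact (hasFDerivAt_intervalIntegral (hf.of_le (by simp)) x).continuousAt
  | succ k ih =>
    intro F _ _ _ f hf
    have hf1 : ContDiff ℝ 1 (fun z : E × ℝ => f z.1 z.2) := hf.of_le (by simp)
    push_cast
    refine contDiff_succ_iff_hasFDerivAt.2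
      ⟨fun x => ∫ s in (0 : ℝ)..1, fderiv ℝ (fun y => f y s) x, ih ?_,
        fun x => hasFDerivAt_intervalIntegral hf1 x⟩
    have h1 : ContDiff ℝ ∞ (Function.uncurry fun (z : E × ℝ) (y : E) => f y z.2) := by
      change ContDiff ℝ ∞ (fun p : (E × ℝ) × E => f p.2 p.1.2)
      exact hf.comp (f := fun p : (E × ℝ) × E => (p.2, p.1.2)) (by fun_prop)
    exact ContDiff.fderiv h1 contDiff_fst (by simp)

/-- An integral over `[0, 1]` of a smooth integrand depends smoothly on parameters. -/
lemma contDiff_intervalIntegral {E F : Type} [NormedAddCommGroup E] [NormedSpace ℝ E]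
    [FiniteDimensional ℝ E] [NormedAddCommGroup F] [NormedSpace ℝ F] [CompleteSpace F]
    {f : E → ℝ → F} (hf : ContDiff ℝ ∞ (fun z : E × ℝ => f z.1 z.2)) :
    ContDiff ℝ ∞ (fun y => ∫ s in (0 : ℝ)..1, f y s) :=
  contDiff_infty.2 fun k => contDiff_intervalIntegral_nat k hf

lemma contDiff_metricIntegral {n : ℕ} {P : Vec n → ℝ → Mat n}
    (hP : ContDiff ℝ ∞ (fun z : Vec n × ℝ => P z.1 z.2)) :
    ContDiff ℝ ∞ (fun z : Vec n × ℝ => metricIntegral P z.1 z.2) := by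
  unfold metricIntegral
  refine contDiff_intervalIntegral
    (f := fun (z : Vec n × ℝ) (s : ℝ) => P (s • z.1) z.2 z.1) ?_
  refine ContDiff.clm_apply ?_ (by fun_prop)
  exact hP.comp (f := fun p : (Vec n × ℝ) × ℝ => (p.2 • p.1.1, p.1.2)) (by fun_prop)

/-! ### Positive definite operators -/

section Operators
variable {n : ℕ}

lemma isInvertible_of_forall_inner_pos {A : Mat n} (h : ∀ v : Vec n, v ≠ 0 → 0 < ⟪v, A v⟫) :
    A.IsInvertible := by
  have hinj : Function.Injective A.toLinearMap := by
    rw [← LinearMap.ker_eq_bot, LinearMap.ker_eq_bot']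
    intro v hv
    by_contra hne
    have := h v hne
    rw [show A v = 0 from hv, inner_zero_right] at this
    exact lt_irrefl _ this
  let e := LinearEquiv.ofInjectiveEndo A.toLinearMap hinj
  exact ⟨e.toContinuousLinearEquiv, by ext v; rfl⟩

lemma PosDef.isInvertible {A : Mat n} (h : PosDef A) : A.IsInvertible :=
  isInvertible_of_forall_inner_pos h.2

lemma IsInvertible.apply_inverse {A : Mat n} (h : A.IsInvertible) (v : Vec n) :
    A (A.inverse v) = v := by
  obtain ⟨e, rfl⟩ := h
  simp

lemma IsInvertible.inverse_apply {A : Mat n} (h : A.IsInvertible) (v : Vec n) :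
    A.inverse (A v) = v := by
  obtain ⟨e, rfl⟩ := h
  simp

lemma contDiffAt_inverse {E : Type} [NormedAddCommGroup E] [NormedSpace ℝ E] {A : E → Mat n}
    {z : E} (hA : ContDiffAt ℝ ∞ A z) (h : (A z).IsInvertible) :
    ContDiffAt ℝ ∞ (fun y => (A y).inverse) z := by
  obtain ⟨e, he⟩ := h
  have h1 : ContDiffAt ℝ ∞ (ContinuousLinearMap.inverse : Mat n → Mat n) (A z) :=
    he ▸ contDiffAt_map_inverse e
  exact h1.comp z hA

lemma inner_apply_comm {A : Mat n} (h : IsSelfAdjoint A) (v w : Vec n) :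
    ⟪A v, w⟫ = ⟪v, A w⟫ := by
  rw [ContinuousLinearMap.isSelfAdjoint_iff'] at h
  conv_lhs => rw [← h]
  exact ContinuousLinearMap.adjoint_inner_left A w v

lemma isSelfAdjoint_inverse {A : Mat n} (h : PosDef A) : IsSelfAdjoint A.inverse := by
  rw [ContinuousLinearMap.isSelfAdjoint_iff_isSymmetric]
  intro v w
  have h1 := IsInvertible.apply_inverse h.isInvertible v
  have h2 := IsInvertible.apply_inverse h.isInvertible w
  calc ⟪A.inverse v, w⟫ = ⟪A.inverse v, A (A.inverse w)⟫ := by rw [h2]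
    _ = ⟪A (A.inverse v), A.inverse w⟫ := (inner_apply_comm h.1 _ _).symm
    _ = ⟪v, A.inverse w⟫ := by rw [h1]

lemma norm_le_of_inner_le {A : Mat n} {c v} (hc : 0 < c) (h : c * ‖v‖ ^ 2 ≤ ⟪v, A v⟫) :
    ‖v‖ ≤ c⁻¹ * ‖A v‖ := by
  have h1 := real_inner_le_norm v (A v)
  rcases eq_or_lt_of_le (norm_nonneg v) with h0 | h0
  · rw [← h0]; positivity
  rw [inv_mul_eq_div, le_div_iff₀ hc]
  nlinarith

/-- A symmetric positive definite operator dominates a positive multiple of the identity. -/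
lemma PosDef.exists_le {A : Mat n} (h : PosDef A) :
    ∃ c : ℝ, 0 < c ∧ ∀ v, c * ‖v‖ ^ 2 ≤ ⟪v, A v⟫ := by
  rcases (Metric.sphere (0 : Vec n) 1).eq_empty_or_nonempty with he | hne
  · refine ⟨1, one_pos, fun v => ?_⟩
    by_cases hv : v = 0
    · simp [hv]
    · exfalso
      have : (‖v‖⁻¹ • v) ∈ Metric.sphere (0 : Vec n) 1 := by
        simp [norm_smul, hv]
      rw [he] at this
      exact this
  · obtain ⟨w, hw, hmin⟩ := (isCompact_sphere (0 : Vec n) 1).exists_isMinOn hne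
      (f := fun v => ⟪v, A v⟫) (by fun_prop)
    have hw1 : ‖w‖ = 1 := by simpa using hw
    refine ⟨⟪w, A w⟫, h.2 w (by rintro rfl; simp at hw1), fun v => ?_⟩
    by_cases hv : v = 0
    · simp [hv]
    · have hv' : 0 < ‖v‖ := norm_pos_iff.2 hv
      have hm : (‖v‖⁻¹ • v) ∈ Metric.sphere (0 : Vec n) 1 := by simp [norm_smul, hv]
      have := isMinOn_iff.1 hmin _ hm
      simp only [map_smul, inner_smul_left, inner_smul_right, RCLike.conj_to_real] at this
      have h2 : ⟪v, A v⟫ = ‖v‖ ^ 2 * (‖v‖⁻¹ * (‖v‖⁻¹ * ⟪v, A v⟫)) := by field_simp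
      rw [h2, mul_comm]
      gcongr

/-! ### Smallest eigenvalues -/

lemma le_of_hasEigenvalue_prodMap {A B : Mat n} {c μ : ℝ} (hA : ∀ v, c * ‖v‖ ^ 2 ≤ ⟪v, A v⟫)
    (hB : ∀ v, c * ‖v‖ ^ 2 ≤ ⟪v, B v⟫)
    (h : Module.End.HasEigenvalue (A.prodMap B).toLinearMap μ) : c ≤ μ := by
  obtain ⟨v, hv⟩ := h.exists_hasEigenvector
  have h1 := hv.apply_eq_smul
  have hAv : A v.1 = μ • v.1 := congrArg Prod.fst h1
  have hBv : B v.2 = μ • v.2 := congrArg Prod.snd h1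
  have hne : 0 < ‖v.1‖ ^ 2 + ‖v.2‖ ^ 2 := by
    by_contra hcon
    refine hv.2 (Prod.ext (norm_eq_zero.1 ?_) (norm_eq_zero.1 ?_)) <;>
      nlinarith [sq_nonneg ‖v.1‖, sq_nonneg ‖v.2‖]
  have h2 := hA v.1
  have h3 := hB v.2
  rw [hAv, inner_smul_right, real_inner_self_eq_norm_sq] at h2
  rw [hBv, inner_smul_right, real_inner_self_eq_norm_sq] at h3
  nlinarith

/-- The minimum of the Rayleigh quotient is an eigenvalue. -/
lemma exists_hasEigenvalue_le {A : Mat n} (hn : 0 < n) (hA : IsSelfAdjoint A) :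
    ∃ μ : ℝ, Module.End.HasEigenvalue A.toLinearMap μ ∧ ∀ v, μ * ‖v‖ ^ 2 ≤ ⟪v, A v⟫ := by
  have : Nonempty (Fin n) := ⟨⟨0, hn⟩⟩
  have hs : A.toLinearMap.IsSymmetric :=
    (ContinuousLinearMap.isSelfAdjoint_iff_isSymmetric).1 hA
  refine ⟨_, hs.hasEigenvalue_iInf_of_finiteDimensional, fun v => ?_⟩
  by_cases hv : v = 0
  · simp [hv]
  have hb : BddBelow (Set.range fun x : { x : Vec n // x ≠ 0 } =>
      (RCLike.re ⟪A.toLinearMap x, (x : Vec n)⟫ / ‖(x : Vec n)‖ ^ 2 : ℝ)) := by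
    refine ⟨-‖A‖, ?_⟩
    rintro _ ⟨⟨x, hx⟩, rfl⟩
    have hx' : 0 < ‖x‖ := norm_pos_iff.2 hx
    have h1 := abs_real_inner_le_norm (A x) x
    have h2 := A.le_opNorm x
    rw [le_div_iff₀ (by positivity)]
    have h3 := (abs_le.1 h1).1
    change _ ≤ ⟪A x, x⟫
    nlinarith
  have h := ciInf_le hb ⟨v, hv⟩
  have hv' : 0 < ‖v‖ := norm_pos_iff.2 hv
  rw [le_div_iff₀ (by positivity)] at h
  refine h.trans (le_of_eq ?_)
  exact real_inner_comm v (A v)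

/-- The smallest eigenvalue of `diag(A, B)` bounds both quadratic forms from below, and it is at
least any common lower bound of theirs. For `n = 0` there is no eigenvalue, and the infimum is the
junk value zero. -/
lemma lambdaMin_prodMap_spec {A B : Mat n} {c : ℝ} (hn : 0 < n) (hA : IsSelfAdjoint A)
    (hB : IsSelfAdjoint B) (hcA : ∀ v, c * ‖v‖ ^ 2 ≤ ⟪v, A v⟫)
    (hcB : ∀ v, c * ‖v‖ ^ 2 ≤ ⟪v, B v⟫) :
    c ≤ Design.lambdaMin (A.prodMap B).toLinearMap ∧
    (∀ v, Design.lambdaMin (A.prodMap B).toLinearMap * ‖v‖ ^ 2 ≤ ⟪v, A v⟫) ∧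
    (∀ v, Design.lambdaMin (A.prodMap B).toLinearMap * ‖v‖ ^ 2 ≤ ⟪v, B v⟫) := by
  have hbdd : BddBelow {μ : ℝ | Module.End.HasEigenvalue (A.prodMap B).toLinearMap μ} :=
    ⟨c, fun μ hμ => le_of_hasEigenvalue_prodMap hcA hcB hμ⟩
  obtain ⟨μ, hμ, hμle⟩ := exists_hasEigenvalue_le hn hA
  obtain ⟨ν, hν, hνle⟩ := exists_hasEigenvalue_le hn hB
  have hμ' : Module.End.HasEigenvalue (A.prodMap B).toLinearMap μ := by
    obtain ⟨v, hv⟩ := hμ.exists_hasEigenvector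
    refine Module.End.hasEigenvalue_of_hasEigenvector (x := (v, 0))
      (Module.End.hasEigenvector_iff.2 ⟨Module.End.mem_eigenspace_iff.2 ?_, ?_⟩)
    · have := hv.apply_eq_smul
      exact Prod.ext this (by simp)
    · intro h
      exact hv.2 (congrArg Prod.fst h)
  have hν' : Module.End.HasEigenvalue (A.prodMap B).toLinearMap ν := by
    obtain ⟨v, hv⟩ := hν.exists_hasEigenvector
    refine Module.End.hasEigenvalue_of_hasEigenvector (x := (0, v))
      (Module.End.hasEigenvector_iff.2 ⟨Module.End.mem_eigenspace_iff.2 ?_, ?_⟩)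
    · have := hv.apply_eq_smul
      exact Prod.ext (by simp) this
    · intro h
      exact hv.2 (congrArg Prod.snd h)
  refine ⟨le_csInf ⟨μ, hμ'⟩ fun ρ hρ => le_of_hasEigenvalue_prodMap hcA hcB hρ,
    fun v => le_trans ?_ (hμle v), fun v => le_trans ?_ (hνle v)⟩
  · exact mul_le_mul_of_nonneg_right (csInf_le hbdd hμ') (sq_nonneg _)
  · exact mul_le_mul_of_nonneg_right (csInf_le hbdd hν') (sq_nonneg _)

/-- The same for a family of block diagonal operators and the infimum over the family. -/
lemma iInf_lambdaMin_prodMap_spec {ι : Type} [Nonempty ι] {A B : ι → Mat n} {c : ℝ} (hn : 0 < n)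
    (hA : ∀ i, IsSelfAdjoint (A i)) (hB : ∀ i, IsSelfAdjoint (B i))
    (hcA : ∀ i v, c * ‖v‖ ^ 2 ≤ ⟪v, A i v⟫) (hcB : ∀ i v, c * ‖v‖ ^ 2 ≤ ⟪v, B i v⟫) :
    c ≤ (⨅ i, Design.lambdaMin ((A i).prodMap (B i)).toLinearMap) ∧ ∀ i v,
    (⨅ i, Design.lambdaMin ((A i).prodMap (B i)).toLinearMap) * ‖v‖ ^ 2 ≤ ⟪v, A i v⟫ ∧
    (⨅ i, Design.lambdaMin ((A i).prodMap (B i)).toLinearMap) * ‖v‖ ^ 2 ≤ ⟪v, B i v⟫ := by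
  have hs := fun i => lambdaMin_prodMap_spec hn (hA i) (hB i) (hcA i) (hcB i)
  refine ⟨le_ciInf fun i => (hs i).1, fun i v => ?_⟩
  have hle : (⨅ i, Design.lambdaMin ((A i).prodMap (B i)).toLinearMap) ≤
      Design.lambdaMin ((A i).prodMap (B i)).toLinearMap :=
    ciInf_le ⟨c, by rintro _ ⟨j, rfl⟩; exact (hs j).1⟩ i
  exact ⟨(mul_le_mul_of_nonneg_right hle (sq_nonneg _)).trans ((hs i).2.1 v),
    (mul_le_mul_of_nonneg_right hle (sq_nonneg _)).trans ((hs i).2.2 v)⟩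

/-- `A² ≥ c A` for a symmetric operator `A ≥ c > 0`. -/
lemma mul_inner_le_norm_apply_sq {A : Mat n} {c : ℝ} (hc : 0 < c) {v : Vec n}
    (h : c * ‖v‖ ^ 2 ≤ ⟪v, A v⟫) : c * ⟪v, A v⟫ ≤ ‖A v‖ ^ 2 := by
  have h1 := real_inner_le_norm v (A v)
  have h2 := norm_le_of_inner_le hc h
  rw [inv_mul_eq_div, le_div_iff₀ hc] at h2
  nlinarith [norm_nonneg v, norm_nonneg (A v)]

end Operators

/-! ### Explicit form of the robot and of its virtual system -/

section Gradients
variable {n : ℕ}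

lemma hasGradientAt_add {f g : Vec n → ℝ} {f' g' x : Vec n} (hf : HasGradientAt f f' x)
    (hg : HasGradientAt g g' x) : HasGradientAt (fun y => f y + g y) (f' + g') x := by
  rw [hasGradientAt_iff_hasFDerivAt] at *
  rw [map_add]
  exact hf.add hg

lemma hasGradientAt_quadratic {A : Mat n} (hA : IsSelfAdjoint A) (x : Vec n) :
    HasGradientAt (fun y => (1 / 2 : ℝ) * ⟪y, A y⟫) (A x) x := by
  rw [hasGradientAt_iff_hasFDerivAt]
  have h := ((hasFDerivAt_id (𝕜 := ℝ) x).inner ℝ (A.hasFDerivAt (x := x))).const_mul (1 / 2 : ℝ)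
  refine h.congr_fderiv ?_
  ext v
  have h1 : ⟪x, A v⟫ = ⟪A x, v⟫ := (inner_apply_comm hA x v).symm
  have h2 : ⟪v, A x⟫ = ⟪A x, v⟫ := real_inner_comm _ _
  simp [h1, h2]
  ring

lemma hasGradientAt_quadratic_sub {A : Mat n} (hA : IsSelfAdjoint A) (c x : Vec n) :
    HasGradientAt (fun y => (1 / 2 : ℝ) * ⟪y - c, A (y - c)⟫) (A (x - c)) x := by
  have h := hasGradientAt_quadratic hA (x - c)
  rw [hasGradientAt_iff_hasFDerivAt] at *
  exact h.comp x (f := fun y => y - c) ((hasFDerivAt_id x).sub_const c)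

lemma hasGradientAt_quadratic_const_sub {A : Mat n} (hA : IsSelfAdjoint A) (c x : Vec n) :
    HasGradientAt (fun y => (1 / 2 : ℝ) * ⟪c - y, A (c - y)⟫) (-A (c - x)) x := by
  have h := hasGradientAt_quadratic_sub hA c x
  have h1 : ∀ y : Vec n, ⟪c - y, A (c - y)⟫ = ⟪y - c, A (y - c)⟫ := by
    intro y
    rw [← neg_sub y c, map_neg, inner_neg_neg]
  simp only [h1]
  rwa [← map_neg, neg_sub]

lemma hasGradientAt_const_add {f : Vec n → ℝ} {f' x : Vec n} (c : ℝ) (hf : HasGradientAt f f' x) :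
    HasGradientAt (fun y => c + f y) f' x := by
  rw [hasGradientAt_iff_hasFDerivAt] at *
  exact hf.const_add c

lemma hasGradientAt_add_const {f : Vec n → ℝ} {f' x : Vec n} (c : ℝ) (hf : HasGradientAt f f' x) :
    HasGradientAt (fun y => f y + c) f' x := by
  rw [hasGradientAt_iff_hasFDerivAt] at *
  exact hf.add_const c

lemma contDiff_gradient {f : Vec n → ℝ} (hf : ContDiff ℝ ∞ f) : ContDiff ℝ ∞ (∇ f) := by
  unfold gradient
  have h : ContDiff ℝ ∞ (fderiv ℝ f) := hf.fderiv_right (by simp)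
  exact (InnerProductSpace.toDual ℝ (Vec n)).symm.toContinuousLinearEquiv.contDiff.comp h

end Gradients

namespace Robot
variable {n : ℕ} (R : Robot n)

lemma isSelfAdjoint_MlInv (q : Vec n) : IsSelfAdjoint (R.MlInv q) :=
  isSelfAdjoint_inverse (R.posDef_Ml q)

lemma isSelfAdjoint_MmInv (q : Vec n) : IsSelfAdjoint (R.MmInv q) :=
  isSelfAdjoint_inverse (R.posDef_Mm q)

lemma contDiff_MlInv : ContDiff ℝ ∞ R.MlInv :=
  contDiff_iff_contDiffAt.2 fun q =>
    contDiffAt_inverse R.smooth_Ml.contDiffAt (R.posDef_Ml q).isInvertible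

lemma contDiff_MmInv : ContDiff ℝ ∞ R.MmInv :=
  contDiff_iff_contDiffAt.2 fun q =>
    contDiffAt_inverse R.smooth_Mm.contDiffAt (R.posDef_Mm q).isInvertible

lemma MlInv_Ml (q v : Vec n) : R.MlInv q (R.Ml q v) = v :=
  IsInvertible.inverse_apply (R.posDef_Ml q).isInvertible v

lemma MmInv_Mm (q v : Vec n) : R.MmInv q (R.Mm q v) = v :=
  IsInvertible.inverse_apply (R.posDef_Mm q).isInvertible v

lemma Bm_inverse (q v : Vec n) : R.Bm q ((R.Bm q).inverse v) = v := by
  obtain ⟨u, hu⟩ := R.isUnit_Bm q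
  refine IsInvertible.apply_inverse ⟨ContinuousLinearEquiv.unitsEquiv ℝ (Vec n) u, ?_⟩ v
  rw [← hu]
  rfl

lemma K_inverse (v : Vec n) : R.K (R.K.inverse v) = v :=
  IsInvertible.apply_inverse R.posDef_K.isInvertible v

lemma differentiable_Pl : Differentiable ℝ R.Pl := R.smooth_Pl.differentiable (by simp)

lemma hasGradientAt_potential_link (q c : Vec n) :
    HasGradientAt (fun y => R.potential (y, c)) (∇ R.Pl q + -R.K (c - q)) q :=
  hasGradientAt_add (R.differentiable_Pl q).hasGradientAt
    (hasGradientAt_quadratic_const_sub R.posDef_K.1 c q)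

lemma hasGradientAt_potential_motor (q c : Vec n) :
    HasGradientAt (fun y => R.potential (c, y)) (R.K (q - c)) q :=
  hasGradientAt_const_add (R.Pl c) (hasGradientAt_quadratic_sub R.posDef_K.1 c q)

lemma virtualField_eq (xv x : State n) (u : Vec n) : R.virtualField xv x u =
    ((R.MlInv (ql x) (pl xv), R.MmInv (qm x) (pm xv)),
      (-(∇ R.Pl (ql xv) + -R.K (qm xv - ql xv)) - (R.El x + R.Dl (ql x)) (R.MlInv (ql x) (pl xv)),
        -R.K (qm xv - ql xv) - (R.Em x + R.Dm (qm x)) (R.MmInv (qm x) (pm xv))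
          + R.Bm (qm x) u)) := by
  have h1 : ∇ (fun y => R.virtualHamiltonian ((y, qm xv), (pl xv, pm xv)) x) (ql xv) =
      ∇ R.Pl (ql xv) + -R.K (qm xv - ql xv) :=
    (hasGradientAt_const_add ((1 / 2 : ℝ) * ⟪pl xv, R.MlInv (ql x) (pl xv)⟫
      + (1 / 2 : ℝ) * ⟪pm xv, R.MmInv (qm x) (pm xv)⟫)
      (R.hasGradientAt_potential_link (ql xv) (qm xv))).gradient
  have h2 : ∇ (fun y => R.virtualHamiltonian ((ql xv, y), (pl xv, pm xv)) x) (qm xv) =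
      R.K (qm xv - ql xv) :=
    (hasGradientAt_const_add ((1 / 2 : ℝ) * ⟪pl xv, R.MlInv (ql x) (pl xv)⟫
      + (1 / 2 : ℝ) * ⟪pm xv, R.MmInv (qm x) (pm xv)⟫)
      (R.hasGradientAt_potential_motor (qm xv) (ql xv))).gradient
  have h3 : ∇ (fun y => R.virtualHamiltonian ((ql xv, qm xv), (y, pm xv)) x) (pl xv) =
      R.MlInv (ql x) (pl xv) :=
    (hasGradientAt_add_const (R.potential (ql xv, qm xv))
      (hasGradientAt_add_const ((1 / 2 : ℝ) * ⟪pm xv, R.MmInv (qm x) (pm xv)⟫)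
        (hasGradientAt_quadratic (R.isSelfAdjoint_MlInv (ql x)) (pl xv)))).gradient
  have h4 : ∇ (fun y => R.virtualHamiltonian ((ql xv, qm xv), (pl xv, y)) x) (pm xv) =
      R.MmInv (qm x) (pm xv) :=
    (hasGradientAt_add_const (R.potential (ql xv, qm xv))
      (hasGradientAt_const_add ((1 / 2 : ℝ) * ⟪pl xv, R.MlInv (ql x) (pl xv)⟫)
        (hasGradientAt_quadratic (R.isSelfAdjoint_MmInv (qm x)) (pm xv)))).gradient
  simp only [virtualField, h1, h2, h3, h4]

lemma hasGradientAt_kinetic {M : Vec n → Mat n} {S : Vec n → Vec n → Mat n}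
    (hM : ContDiff ℝ ∞ fun q => (M q).inverse) (hS : IsGyroscopic M S) (q p : Vec n) :
    HasGradientAt (fun y : Vec n => (1 / 2 : ℝ) * ⟪p, (M y).inverse p⟫)
      ((S q p - (1 / 2 : ℝ) • inertiaRate M q p) ((M q).inverse p)) q := by
  rw [← hS.2 q p]
  refine DifferentiableAt.hasGradientAt ?_
  have h : Differentiable ℝ fun q => (M q).inverse := hM.differentiable (by simp)
  exact ((differentiableAt_const p).inner ℝ
    ((h q).clm_apply (differentiableAt_const p))).const_mul _

/-- The robot is the virtual system at `x_v = x`: the gyroscopic identity replaces the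
configuration gradient of the kinetic energy by the workless forces. -/
lemma field_eq (x : State n) (u : Vec n) : R.field x u = R.virtualField x x u := by
  have h1 : ∇ (fun y => R.hamiltonian ((y, qm x), (pl x, pm x))) (ql x) =
      R.El x (R.MlInv (ql x) (pl x)) + (∇ R.Pl (ql x) + -R.K (qm x - ql x)) :=
    (hasGradientAt_add (hasGradientAt_add_const ((1 / 2 : ℝ) * ⟪pm x, R.MmInv (qm x) (pm x)⟫)
      (hasGradientAt_kinetic R.contDiff_MlInv R.gyroscopic_Sl (ql x) (pl x)))
      (R.hasGradientAt_potential_link (ql x) (qm x))).gradient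
  have h2 : ∇ (fun y => R.hamiltonian ((ql x, y), (pl x, pm x))) (qm x) =
      R.Em x (R.MmInv (qm x) (pm x)) + R.K (qm x - ql x) :=
    (hasGradientAt_add (hasGradientAt_const_add ((1 / 2 : ℝ) * ⟪pl x, R.MlInv (ql x) (pl x)⟫)
      (hasGradientAt_kinetic R.contDiff_MmInv R.gyroscopic_Sm (qm x) (pm x)))
      (R.hasGradientAt_potential_motor (qm x) (ql x))).gradient
  have h3 : ∇ (fun y => R.hamiltonian ((ql x, qm x), (y, pm x))) (pl x) =
      R.MlInv (ql x) (pl x) :=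
    (hasGradientAt_add_const (R.potential (ql x, qm x))
      (hasGradientAt_add_const ((1 / 2 : ℝ) * ⟪pm x, R.MmInv (qm x) (pm x)⟫)
        (hasGradientAt_quadratic (R.isSelfAdjoint_MlInv (ql x)) (pl x)))).gradient
  have h4 : ∇ (fun y => R.hamiltonian ((ql x, qm x), (pl x, y))) (pm x) =
      R.MmInv (qm x) (pm x) :=
    (hasGradientAt_add_const (R.potential (ql x, qm x))
      (hasGradientAt_const_add ((1 / 2 : ℝ) * ⟪pl x, R.MlInv (ql x) (pl x)⟫)
        (hasGradientAt_quadratic (R.isSelfAdjoint_MmInv (qm x)) (pm x)))).gradient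
  rw [virtualField_eq]
  simp only [field, h1, h2, h3, h4, add_apply]
  refine Prod.ext rfl (Prod.ext ?_ ?_)
  · simp only []
    abel
  · simp only []
    abel

/-! ### Smoothness of the dynamics -/

lemma contDiff_inertiaRate {M : Vec n → Mat n} (hM : ContDiff ℝ ∞ M)
    (hM' : ContDiff ℝ ∞ fun q => (M q).inverse) :
    ContDiff ℝ ∞ (fun z : Vec n × Vec n => inertiaRate M z.1 z.2) := by
  unfold inertiaRate
  have h : ContDiff ℝ ∞ (fderiv ℝ M) := hM.fderiv_right (by simp)
  exact (h.comp contDiff_fst).clm_apply ((hM'.comp contDiff_fst).clm_apply contDiff_snd)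

lemma contDiff_El : ContDiff ℝ ∞ R.El := by
  unfold El
  have hz : ContDiff ℝ ∞ (fun x : State n => (ql x, pl x)) := by unfold ql pl; fun_prop
  exact (R.smooth_Sl.comp hz).sub
    (((contDiff_inertiaRate R.smooth_Ml R.contDiff_MlInv).comp hz).const_smul (1 / 2 : ℝ))

lemma contDiff_Em : ContDiff ℝ ∞ R.Em := by
  unfold Em
  have hz : ContDiff ℝ ∞ (fun x : State n => (qm x, pm x)) := by unfold qm pm; fun_prop
  exact (R.smooth_Sm.comp hz).sub
    (((contDiff_inertiaRate R.smooth_Mm R.contDiff_MmInv).comp hz).const_smul (1 / 2 : ℝ))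

lemma contDiff_virtualField :
    ContDiff ℝ ∞ (fun z : State n × State n => R.virtualField z.1 z.2 0) := by
  simp only [virtualField_eq, map_zero, add_zero]
  have h1 := R.contDiff_MlInv
  have h2 := R.contDiff_MmInv
  have h3 := R.contDiff_El
  have h4 := R.contDiff_Em
  have h5 := R.smooth_Dl
  have h6 := R.smooth_Dm
  have h7 := contDiff_gradient R.smooth_Pl
  unfold ql qm pl pm
  fun_prop

lemma contDiff_field : ContDiff ℝ ∞ (fun x : State n => R.field x 0) := by
  simp only [field_eq]
  exact R.contDiff_virtualField.comp (f := fun x : State n => (x, x)) (by fun_prop)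

lemma contDiff_totalDeriv {F : Type} [NormedAddCommGroup F] [NormedSpace ℝ F]
    {g : State n → State n → ℝ → F}
    (hg : ContDiff ℝ ∞ (fun y : State n × State n × ℝ => g y.1 y.2.1 y.2.2)) :
    ContDiff ℝ ∞ (fun y : State n × State n × ℝ => R.totalDeriv g y.1 y.2.1 y.2.2) := by
  unfold totalDeriv
  have h1 : ContDiff ℝ ∞ (fderiv ℝ (fun y : State n × State n × ℝ => g y.1 y.2.1 y.2.2)) :=
    hg.fderiv_right (by simp)
  have h2 := R.contDiff_virtualField.comp
    (f := fun y : State n × State n × ℝ => (y.1, y.2.1)) (by fun_prop)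
  have h3 := R.contDiff_field.comp
    (f := fun y : State n × State n × ℝ => y.2.1) (by fun_prop)
  exact h1.clm_apply (h2.prodMk (h3.prodMk contDiff_const))

end Robot

/-! ### Time derivatives of quantities that do not depend on the motor momenta -/

section Dependence
variable {n : ℕ} {F : Type}

/-- `g(x_v, x, t)` depends on `x_v` and `x` through the linear observables `L x_v` and `L x`
only. -/
def DependsOn {W : Type} [AddCommGroup W] [Module ℝ W] (L : State n →ₗ[ℝ] W)
    (g : State n → State n → ℝ → F) : Prop :=
  ∀ xv xv' x x' t, L xv = L xv' → L x = L x' → g xv x t = g xv' x' t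

lemma DependsOn.mono {W W' : Type} [AddCommGroup W] [Module ℝ W]
     [AddCommGroup W'] [Module ℝ W'] 
    {L : State n →ₗ[ℝ] W} {L' : State n →ₗ[ℝ] W'}
    {g : State n → State n → ℝ → F} (hg : DependsOn L g)
    (hL : ∀ x x', L' x = L' x' → L x = L x') : DependsOn L' g :=
  fun xv xv' x x' t hv hx => hg xv xv' x x' t (hL _ _ hv) (hL _ _ hx)

/-- The link positions `q_ℓ`. -/
def linkPos : State n →ₗ[ℝ] Vec n := LinearMap.fst ℝ _ _ ∘ₗ LinearMap.fst ℝ _ _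

/-- The link positions and momenta `(q_ℓ, p_ℓ)`. -/
def linkState : State n →ₗ[ℝ] Vec n × Vec n :=
  LinearMap.prod linkPos (LinearMap.fst ℝ _ _ ∘ₗ LinearMap.snd ℝ _ _)

/-- All components `(q, p_ℓ)` of the state but the motor momenta. -/
def withoutMotorMomenta : State n →ₗ[ℝ] (Vec n × Vec n) × Vec n :=
  LinearMap.prod (LinearMap.fst ℝ _ _) (LinearMap.fst ℝ _ _ ∘ₗ LinearMap.snd ℝ _ _)

lemma linkPos_apply (x : State n) : linkPos x = ql x := rfl
lemma linkState_apply (x : State n) : linkState x = (ql x, pl x) := rfl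
lemma withoutMotorMomenta_apply (x : State n) :
    withoutMotorMomenta x = ((ql x, qm x), pl x) := rfl

variable [NormedAddCommGroup F] [NormedSpace ℝ F]

lemma fderiv_apply_eq_zero_of_invariant {E : Type} [NormedAddCommGroup E] [NormedSpace ℝ E]
    {f : E → F} {y k : E} (hf : DifferentiableAt ℝ f y) (h : ∀ s : ℝ, f (y + s • k) = f y) :
    fderiv ℝ f y k = 0 := by
  have h1 : HasLineDerivAt ℝ f (fderiv ℝ f y k) y k := hf.hasFDerivAt.hasLineDerivAt k
  have h2 : HasDerivAt (fun s : ℝ => f (y + s • k)) (fderiv ℝ f y k) 0 := h1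
  simp only [h] at h2
  exact h2.unique (hasDerivAt_const 0 (f y))

variable {W : Type} [AddCommGroup W] [Module ℝ W] {L : State n →ₗ[ℝ] W}
  {g : State n → State n → ℝ → F}

lemma DependsOn.fderiv_apply_congr (hg : DependsOn L g) {xv x : State n} {t : ℝ}
    (hd : DifferentiableAt ℝ (fun y : State n × State n × ℝ => g y.1 y.2.1 y.2.2) (xv, x, t))
    {v v' w w' : State n} (hv : L v = L v') (hw : L w = L w') (r : ℝ) :
    fderiv ℝ (fun y : State n × State n × ℝ => g y.1 y.2.1 y.2.2) (xv, x, t) (v, w, r) =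
      fderiv ℝ (fun y : State n × State n × ℝ => g y.1 y.2.1 y.2.2) (xv, x, t) (v', w', r) := by
  rw [← sub_eq_zero, ← map_sub]
  refine fderiv_apply_eq_zero_of_invariant hd fun s => ?_
  simp only [Prod.mk_sub_mk, Prod.smul_mk, Prod.mk_add_mk, sub_self, smul_zero, add_zero]
  exact hg _ _ _ _ _ (by simp [hv]) (by simp [hw])

lemma DependsOn.fderiv_congr (hg : DependsOn L g) {xv xv' x x' : State n} (t : ℝ)
    (hv : L xv = L xv') (hx : L x = L x') :
    fderiv ℝ (fun y : State n × State n × ℝ => g y.1 y.2.1 y.2.2) (xv, x, t) =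
      fderiv ℝ (fun y : State n × State n × ℝ => g y.1 y.2.1 y.2.2) (xv', x', t) := by
  have h := fderiv_comp_add_right (𝕜 := ℝ)
    (f := fun y : State n × State n × ℝ => g y.1 y.2.1 y.2.2) (x := (xv, x, t))
    (xv' - xv, x' - x, 0)
  have h1 : (xv, x, t) + (xv' - xv, x' - x, (0 : ℝ)) = (xv', x', t) := by simp
  rw [h1] at h
  rw [← h]
  congr 1
  funext y
  simp only [Prod.fst_add, Prod.snd_add, add_zero]
  exact hg _ _ _ _ _ (by simp [hv]) (by simp [hx])

/-- If `L` evolves autonomously in terms of `L'`, then the time derivative of a quantity that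
depends on `L` depends on `L'`. -/
lemma DependsOn.totalDeriv {W' : Type} [AddCommGroup W'] [Module ℝ W'] {L' : State n →ₗ[ℝ] W'}
    (R : Robot n) (hg : DependsOn L g)
    (hd : Differentiable ℝ (fun y : State n × State n × ℝ => g y.1 y.2.1 y.2.2))
    (hL : ∀ x x', L' x = L' x' → L x = L x')
    (hf : ∀ xv xv' x x', L' xv = L' xv' → L' x = L' x' →
      L (R.virtualField xv x 0) = L (R.virtualField xv' x' 0)) :
    DependsOn L' (R.totalDeriv g) := by
  intro xv xv' x x' t hv hx
  unfold Robot.totalDeriv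
  rw [hg.fderiv_congr t (hL _ _ hv) (hL _ _ hx)]
  refine hg.fderiv_apply_congr (hd _) (hf _ _ _ _ hv hx) ?_ 1
  rw [R.field_eq, R.field_eq]
  exact hf _ _ _ _ hx hx

/-- Along a solution of the robot, with any input, the time derivative of a quantity that does not
depend on the motor momenta is its total derivative at `x_v = x`. -/
lemma DependsOn.hasDerivWithinAt (R : Robot n) (hg : DependsOn withoutMotorMomenta g)
    {x : ℝ → State n} {J : Set ℝ} {t : ℝ} {u : Vec n}
    (hd : DifferentiableAt ℝ (fun y : State n × State n × ℝ => g y.1 y.2.1 y.2.2) (x t, x t, t))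
    (hx : HasDerivWithinAt x (R.field (x t) u) J t) :
    HasDerivWithinAt (fun s => g (x s) (x s) s) (R.totalDeriv g (x t) (x t) t) J t := by
  have h := hd.hasFDerivAt.comp_hasDerivWithinAt t
    (f := fun s => (x s, x s, s)) (hx.prodMk (hx.prodMk (hasDerivWithinAt_id t J)))
  have hu : withoutMotorMomenta (R.field (x t) u) = withoutMotorMomenta (R.field (x t) 0) := by
    simp only [R.field_eq, R.virtualField_eq]
    rfl
  refine h.congr_deriv ?_
  unfold Robot.totalDeriv
  rw [← R.field_eq]
  exact hg.fderiv_apply_congr hd hu hu 1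

end Dependence

/-! ### Smoothness and dependence of the references -/

section TotalDeriv
variable {n : ℕ} {F : Type} [NormedAddCommGroup F] [NormedSpace ℝ F] (R : Robot n)

lemma Robot.totalDeriv_sub {g h : State n → State n → ℝ → F} {xv x : State n} {t : ℝ}
    (hg : DifferentiableAt ℝ (fun y : State n × State n × ℝ => g y.1 y.2.1 y.2.2) (xv, x, t))
    (hh : DifferentiableAt ℝ (fun y : State n × State n × ℝ => h y.1 y.2.1 y.2.2) (xv, x, t)) :
    R.totalDeriv (fun yv y s => g yv y s - h yv y s) xv x t =
      R.totalDeriv g xv x t - R.totalDeriv h xv x t := by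
  unfold totalDeriv
  rw [fderiv_fun_sub hg hh]
  rfl

lemma Robot.totalDeriv_linear (L : State n →L[ℝ] F) (xv x : State n) (t : ℝ) :
    R.totalDeriv (fun yv _ _ => L yv) xv x t = L (R.virtualField xv x 0) := by
  unfold totalDeriv
  have h : HasFDerivAt (fun y : State n × State n × ℝ => L y.1)
      (L.comp (ContinuousLinearMap.fst ℝ _ _)) (xv, x, t) :=
    (L.comp (ContinuousLinearMap.fst ℝ (State n) (State n × ℝ))).hasFDerivAt
  rw [h.fderiv]
  rfl

lemma Robot.totalDeriv_time {c : ℝ → F} {t : ℝ} (hc : DifferentiableAt ℝ c t) (xv x : State n) :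
    R.totalDeriv (fun _ _ s => c s) xv x t = deriv c t := by
  unfold totalDeriv
  have h : HasFDerivAt (fun y : State n × State n × ℝ => y.2.2)
      ((ContinuousLinearMap.snd ℝ _ _).comp (ContinuousLinearMap.snd ℝ _ _)) (xv, x, t) :=
    ((ContinuousLinearMap.snd ℝ _ _).comp
      (ContinuousLinearMap.snd ℝ (State n) (State n × ℝ))).hasFDerivAt
  have h2 := hc.hasDerivAt.hasFDerivAt.comp (xv, x, t) h
  change fderiv ℝ (c ∘ fun y : State n × State n × ℝ => y.2.2) (xv, x, t) _ = _
  rw [h2.fderiv]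
  simp

lemma Robot.totalDeriv_comp {P : Vec n → ℝ → F} {e : State n → State n → ℝ → Vec n}
    {xv x : State n} {t : ℝ} (hP : Differentiable ℝ (fun z : Vec n × ℝ => P z.1 z.2))
    (he : DifferentiableAt ℝ (fun y : State n × State n × ℝ => e y.1 y.2.1 y.2.2) (xv, x, t)) :
    R.totalDeriv (fun yv y s => P (e yv y s) s) xv x t =
      fderiv ℝ (fun z : Vec n × ℝ => P z.1 z.2) (e xv x t, t) (R.totalDeriv e xv x t, 1) := by
  unfold totalDeriv
  have h1 : HasFDerivAt (fun y : State n × State n × ℝ => y.2.2)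
      ((ContinuousLinearMap.snd ℝ _ _).comp (ContinuousLinearMap.snd ℝ _ _)) (xv, x, t) :=
    ((ContinuousLinearMap.snd ℝ _ _).comp
      (ContinuousLinearMap.snd ℝ (State n) (State n × ℝ))).hasFDerivAt
  have h2 := (hP (e xv x t, t)).hasFDerivAt.comp (xv, x, t)
    (f := fun y : State n × State n × ℝ => (e y.1 y.2.1 y.2.2, y.2.2)) (he.hasFDerivAt.prodMk h1)
  change fderiv ℝ ((fun z : Vec n × ℝ => P z.1 z.2) ∘
    fun y : State n × State n × ℝ => (e y.1 y.2.1 y.2.2, y.2.2)) (xv, x, t) _ = _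
  rw [h2.fderiv]
  rfl

end TotalDeriv

namespace Design
variable {n : ℕ} {d : Design n} {R : Robot n}

lemma Admissible.contDiff_deriv_qld (hd : d.Admissible R) : ContDiff ℝ ∞ (deriv d.qld) :=
  (contDiff_infty_iff_deriv.1 hd.smooth_qld).2

lemma Admissible.contDiff_errL (hd : d.Admissible R) :
    ContDiff ℝ ∞ (fun y : State n × State n × ℝ => d.errL y.1 y.2.1 y.2.2) := by
  have h1 := hd.smooth_qld
  unfold errL ql
  fun_prop

lemma Admissible.contDiff_plr (hd : d.Admissible R) :
    ContDiff ℝ ∞ (fun y : State n × State n × ℝ => d.plr R y.1 y.2.1 y.2.2) := by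
  have h1 := hd.contDiff_deriv_qld
  have h2 := hd.smooth_φl
  have h3 := hd.contDiff_errL
  have h4 := R.smooth_Ml
  unfold plr ql
  fun_prop

lemma Admissible.contDiff_sigmaL (hd : d.Admissible R) :
    ContDiff ℝ ∞ (fun y : State n × State n × ℝ => d.sigmaL R y.1 y.2.1 y.2.2) := by
  have h1 := hd.contDiff_plr
  unfold sigmaL pl
  fun_prop

lemma Admissible.contDiff_ul (hd : d.Admissible R) :
    ContDiff ℝ ∞ (fun y : State n × State n × ℝ => d.ul R y.1 y.2.1 y.2.2) := by
  have h1 := R.contDiff_totalDeriv hd.contDiff_plr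
  have h2 := hd.contDiff_plr
  have h3 := hd.contDiff_errL
  have h4 := hd.contDiff_sigmaL
  have h5 := contDiff_gradient R.smooth_Pl
  have h6 := R.contDiff_El
  have h7 := R.smooth_Dl
  have h8 := R.contDiff_MlInv
  have h9 : ContDiff ℝ ∞ (fun y : State n × State n × ℝ =>
      metricIntegral d.PiL (d.errL y.1 y.2.1 y.2.2) y.2.2) :=
    (contDiff_metricIntegral hd.smooth_PiL).comp
      (f := fun y : State n × State n × ℝ => (d.errL y.1 y.2.1 y.2.2, y.2.2)) (by fun_prop)
  unfold ul ql
  fun_prop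

lemma Admissible.contDiff_qmd (hd : d.Admissible R) :
    ContDiff ℝ ∞ (fun y : State n × State n × ℝ => d.qmd R y.1 y.2.1 y.2.2) := by
  have h1 := hd.contDiff_ul
  unfold qmd ql
  fun_prop

lemma Admissible.contDiff_errM (hd : d.Admissible R) :
    ContDiff ℝ ∞ (fun y : State n × State n × ℝ => d.errM R y.1 y.2.1 y.2.2) := by
  have h1 := hd.contDiff_qmd
  unfold errM qm
  fun_prop

lemma Admissible.isInvertible_PiM (hd : d.Admissible R) (z : Vec n) {t : ℝ} (ht : 0 ≤ t) :
    (d.PiM z t).IsInvertible := by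
  obtain ⟨c₁, c₂, hc, h⟩ := hd.uniform_metric
  refine isInvertible_of_forall_inner_pos fun v hv => lt_of_lt_of_le ?_ ((h v).2.1 z t ht).1
  have := norm_pos_iff.2 hv
  positivity

/-- For negative times the motor metric may be singular, so smoothness is claimed for `t ≥ 0`. -/
lemma Admissible.contDiffAt_pmr (hd : d.Admissible R) (xv x : State n) {t : ℝ} (ht : 0 ≤ t) :
    ContDiffAt ℝ ∞ (fun y : State n × State n × ℝ => d.pmr R y.1 y.2.1 y.2.2) (xv, x, t) := by
  have h1 := (R.contDiff_totalDeriv hd.contDiff_qmd).contDiffAt (x := (xv, x, t))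
  have h2 := (hd.smooth_φm.comp hd.contDiff_errM).contDiffAt (x := (xv, x, t))
  have h3 := R.smooth_Mm
  have h4 := (hd.contDiff_sigmaL (R := R)).contDiffAt (x := (xv, x, t))
  have h5 := R.contDiff_MlInv
  have h6 : ContDiffAt ℝ ∞ (fun y : State n × State n × ℝ =>
      (d.PiM (d.errM R y.1 y.2.1 y.2.2) y.2.2).inverse) (xv, x, t) := by
    refine contDiffAt_inverse (ContDiff.contDiffAt ?_) (hd.isInvertible_PiM _ ht)
    have := hd.contDiff_errM (R := R)
    exact hd.smooth_PiM.comp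
      (f := fun y : State n × State n × ℝ => (d.errM R y.1 y.2.1 y.2.2, y.2.2)) (by fun_prop)
  have h7 : ContDiffAt ℝ ∞ (fun y : State n × State n × ℝ => R.Mm (qm y.2.1)) (xv, x, t) := by
    unfold qm; fun_prop
  have h8 : ContDiffAt ℝ ∞ (fun y : State n × State n × ℝ => R.MlInv (ql y.2.1)) (xv, x, t) := by
    unfold ql; fun_prop
  unfold pmr
  exact h7.clm_apply ((h1.sub h2).sub
    (h6.clm_apply (contDiffAt_const.clm_apply (h8.clm_apply h4))))

lemma dependsOn_plr (d : Design n) (R : Robot n) : DependsOn linkPos (d.plr R) := by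
  intro xv xv' x x' t hv hx
  simp only [linkPos_apply] at hv hx
  simp only [plr, errL, hv, hx]

lemma Admissible.dependsOn_totalDeriv_plr (hd : d.Admissible R) :
    DependsOn linkState (R.totalDeriv (d.plr R)) := by
  refine (d.dependsOn_plr R).totalDeriv R (hd.contDiff_plr.differentiable (by simp)) ?_ ?_
  · intro x x' h
    simp only [linkState_apply, Prod.mk.injEq] at h
    exact h.1
  · intro xv xv' x x' hv hx
    simp only [linkState_apply, Prod.mk.injEq] at hv hx
    simp only [R.virtualField_eq, linkPos_apply]
    simp only [ql, pl] at hv hx ⊢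
    simp only [hv, hx]

lemma Admissible.dependsOn_qmd (hd : d.Admissible R) : DependsOn linkState (d.qmd R) := by
  intro xv xv' x x' t hv hx
  have h := hd.dependsOn_totalDeriv_plr xv xv' x x' t hv hx
  simp only [linkState_apply, Prod.mk.injEq] at hv hx
  simp only [qmd, ul, h, sigmaL, plr, errL, Robot.El, hv.1, hv.2, hx.1, hx.2]

lemma Admissible.dependsOn_totalDeriv_qmd (hd : d.Admissible R) :
    DependsOn withoutMotorMomenta (R.totalDeriv (d.qmd R)) := by
  refine hd.dependsOn_qmd.totalDeriv R (hd.contDiff_qmd.differentiable (by simp)) ?_ ?_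
  · intro x x' h
    simp only [withoutMotorMomenta_apply, Prod.mk.injEq] at h
    simp only [linkState_apply, h]
  · intro xv xv' x x' hv hx
    simp only [withoutMotorMomenta_apply, Prod.mk.injEq] at hv hx
    simp only [R.virtualField_eq, linkState_apply, Robot.El]
    simp only [ql, pl, qm] at hv hx ⊢
    simp only [hv, hx]

lemma Admissible.dependsOn_pmr (hd : d.Admissible R) :
    DependsOn withoutMotorMomenta (d.pmr R) := by
  intro xv xv' x x' t hv hx
  have h := hd.dependsOn_totalDeriv_qmd xv xv' x x' t hv hx
  simp only [withoutMotorMomenta_apply, Prod.mk.injEq] at hv hx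
  have h2 := hd.dependsOn_qmd xv xv' x x' t (by simp only [linkState_apply, hv])
    (by simp only [linkState_apply, hx])
  simp only [pmr, h, h2, errM, sigmaL, plr, errL, hv, hx]

end Design

/-! ### Consequences of the matrix inequality -/

section Metric
variable {n : ℕ} {P : Vec n → ℝ → Mat n} {φ : Vec n → Vec n} {β : Vec n → ℝ → ℝ}

/-- The matrix inequality at a point `(z, t)`, for an arbitrary velocity `w` of `z`. -/
def FreeMetricInequality (P : Vec n → ℝ → Mat n) (φ : Vec n → Vec n) (β : Vec n → ℝ → ℝ) : Prop :=
  ∀ z w : Vec n, ∀ t : ℝ, 0 ≤ t → ∀ v : Vec n,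
    ⟪v, (fderiv ℝ (fun z : Vec n × ℝ => P z.1 z.2) (z, t) (w, 1) - P z t ∘L fderiv ℝ φ z
      - ContinuousLinearMap.adjoint (fderiv ℝ φ z) ∘L P z t) v⟫ ≤ -2 * β z t * ⟪v, P z t v⟫

lemma eq_zero_of_forall_mul_le {a c : ℝ} (h : ∀ s : ℝ, s * a ≤ c) : a = 0 := by
  by_contra ha
  have h1 := h ((c + 1) / a)
  rw [div_mul_cancel₀ _ ha] at h1
  linarith

/-- The inequality bounds a linear function of the velocity from above, so the metric cannot
depend on the position. -/
lemma FreeMetricInequality.eq_zero_pos (h : FreeMetricInequality P φ β)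
    (hP : ContDiff ℝ ∞ (fun z : Vec n × ℝ => P z.1 z.2))
    (hsa : ∀ z t, 0 ≤ t → IsSelfAdjoint (P z t)) (z : Vec n) {t : ℝ} (ht : 0 ≤ t) :
    P z t = P 0 t := by
  have hdP : Differentiable ℝ (fun z : Vec n × ℝ => P z.1 z.2) := hP.differentiable (by simp)
  have hder : ∀ v y : Vec n, HasFDerivAt (fun y => ⟪v, P y t v⟫)
      ((innerSL ℝ v).comp (((ContinuousLinearMap.apply ℝ (Vec n) v)).comp
        ((fderiv ℝ (fun z : Vec n × ℝ => P z.1 z.2) (y, t)).comp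
          ((ContinuousLinearMap.id ℝ (Vec n)).prod 0)))) y := by
    intro v y
    have h1 : HasFDerivAt (fun y => P y t) ((fderiv ℝ (fun z : Vec n × ℝ => P z.1 z.2) (y, t)).comp
          ((ContinuousLinearMap.id ℝ (Vec n)).prod 0)) y :=
      (hdP (y, t)).hasFDerivAt.comp y (f := fun y : Vec n => (y, t))
        ((hasFDerivAt_id y).prodMk (hasFDerivAt_const t y))
    exact (innerSL ℝ v).hasFDerivAt.comp y
      ((ContinuousLinearMap.apply ℝ (Vec n) v).hasFDerivAt.comp y h1)
  have hzero : ∀ v y w : Vec n,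
      ⟪v, fderiv ℝ (fun z : Vec n × ℝ => P z.1 z.2) (y, t) (w, 0) v⟫ = 0 := by
    intro v y w
    set A := fderiv ℝ (fun z : Vec n × ℝ => P z.1 z.2) (y, t) with hA
    refine eq_zero_of_forall_mul_le (c := -2 * β y t * ⟪v, P y t v⟫ -
      ⟪v, (A (0, 1) - P y t ∘L fderiv ℝ φ y
        - ContinuousLinearMap.adjoint (fderiv ℝ φ y) ∘L P y t) v⟫) fun s => ?_
    have h1 := h y (s • w) t ht v
    have h2 : A (s • w, 1) = s • A (w, 0) + A (0, 1) := by
      rw [← map_smul, ← map_add]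
      simp
    rw [← hA, h2, add_sub_assoc, add_sub_assoc, add_apply, inner_add_right] at h1
    simp only [smul_apply, inner_smul_right] at h1
    linarith
  have hconst : ∀ v, ⟪v, P z t v⟫ = ⟪v, P 0 t v⟫ := fun v =>
    is_const_of_fderiv_eq_zero (fun y => (hder v y).differentiableAt)
      (fun y => by
        rw [(hder v y).fderiv]
        ext w
        exact hzero v y w) z 0
  have hsym := (ContinuousLinearMap.isSelfAdjoint_iff_isSymmetric.1 (hsa z t ht)).sub
    (ContinuousLinearMap.isSelfAdjoint_iff_isSymmetric.1 (hsa 0 t ht))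
  have h0 := hsym.inner_map_self_eq_zero.1 fun v => by
    change ⟪P z t v - P 0 t v, v⟫ = 0
    rw [real_inner_comm, inner_sub_right, hconst v, sub_self]
  ext1 v
  have := LinearMap.congr_fun h0 v
  exact sub_eq_zero.1 this

lemma metricIntegral_eq (hc : ∀ z t, 0 ≤ t → P z t = P 0 t) (z : Vec n) {t : ℝ} (ht : 0 ≤ t) :
    metricIntegral P z t = P 0 t z := by
  unfold metricIntegral
  simp [hc _ t ht]

lemma hasDerivAt_metric (hP : ContDiff ℝ ∞ (fun z : Vec n × ℝ => P z.1 z.2)) (z : Vec n) (t : ℝ) :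
    HasDerivAt (fun s => P z s) (fderiv ℝ (fun z : Vec n × ℝ => P z.1 z.2) (z, t) (0, 1)) t := by
  have hdP : Differentiable ℝ (fun z : Vec n × ℝ => P z.1 z.2) := hP.differentiable (by simp)
  exact (hdP (z, t)).hasFDerivAt.comp_hasDerivAt t (f := fun s => (z, s))
    ((hasDerivAt_const t z).prodMk (hasDerivAt_id t))

/-- The time derivative is independent of the position, too; at `t = 0` it is determined by the
nonnegative times. -/
lemma fderiv_metric_eq_deriv (hP : ContDiff ℝ ∞ (fun z : Vec n × ℝ => P z.1 z.2))
    (hc : ∀ z t, 0 ≤ t → P z t = P 0 t) (z : Vec n) {t : ℝ} (ht : 0 ≤ t) :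
    fderiv ℝ (fun z : Vec n × ℝ => P z.1 z.2) (z, t) (0, 1) = deriv (fun s => P 0 s) t := by
  have h1 := (hasDerivAt_metric hP z t).hasDerivWithinAt (s := Set.Ici 0)
  have h2 := (hasDerivAt_metric hP 0 t).differentiableAt.hasDerivAt.hasDerivWithinAt
    (s := Set.Ici 0)
  have h3 := h2.congr (f₁ := fun s => P z s) (fun s hs => hc z s hs) (hc z t ht)
  exact (uniqueDiffOn_Ici (0 : ℝ) t ht).eq_deriv _ h1 h3

/-- Integrating the matrix inequality along the segment from `0` to `z` gives the decay of the
quadratic form of the metric along `ż = -φ(z)`. -/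
lemma FreeMetricInequality.integrated (h : FreeMetricInequality P φ β)
    (hP : ContDiff ℝ ∞ (fun z : Vec n × ℝ => P z.1 z.2))
    (hsa : ∀ z t, 0 ≤ t → IsSelfAdjoint (P z t)) (hφ : Differentiable ℝ φ) (hφ0 : φ 0 = 0)
    {b : ℝ} (hb : ∀ z t, 0 ≤ t → b ≤ β z t) (hpos : ∀ z t v, 0 ≤ t → 0 ≤ ⟪v, P z t v⟫)
    (z : Vec n) {t : ℝ} (ht : 0 ≤ t) :
    ⟪z, deriv (fun s => P 0 s) t z⟫ - 2 * ⟪z, P 0 t (φ z)⟫ ≤ -2 * b * ⟪z, P 0 t z⟫ := by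
  have hc : ∀ z t, 0 ≤ t → P z t = P 0 t := fun z t ht => h.eq_zero_pos hP hsa z ht
  set N := P 0 t with hN
  set N' := deriv (fun s => P 0 s) t with hN'
  set c := ⟪z, N' z⟫ + 2 * b * ⟪z, N z⟫ with hcdef
  have hder : ∀ s : ℝ, HasDerivAt (fun s : ℝ => 2 * ⟪z, N (φ (s • z))⟫ - s * c)
      (2 * ⟪z, N (fderiv ℝ φ (s • z) z)⟫ - c) s := by
    intro s
    have h1 : HasDerivAt (fun s : ℝ => s • z) z s := by
      simpa using (hasDerivAt_id s).smul_const z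
    have h2 := (hφ (s • z)).hasFDerivAt.comp_hasDerivAt s h1
    have h3 := N.hasFDerivAt.comp_hasDerivAt s h2
    have h4 := (innerSL ℝ z).hasFDerivAt.comp_hasDerivAt s h3
    have h5 := (h4.const_mul 2).fun_sub ((hasDerivAt_id s).mul_const c)
    simpa using h5
  have hnonneg : ∀ s : ℝ, 0 ≤ 2 * ⟪z, N (fderiv ℝ φ (s • z) z)⟫ - c := by
    intro s
    have h1 := h (s • z) 0 t ht z
    rw [fderiv_metric_eq_deriv hP hc _ ht, hc (s • z) t ht, ← hN, ← hN'] at h1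
    simp only [sub_apply, ContinuousLinearMap.comp_apply, inner_sub_right,
      ContinuousLinearMap.adjoint_inner_right] at h1
    have h2 : ⟪fderiv ℝ φ (s • z) z, N z⟫ = ⟪z, N (fderiv ℝ φ (s • z) z)⟫ := by
      rw [← inner_apply_comm (hsa 0 t ht), real_inner_comm]
    have h3 := mul_le_mul_of_nonneg_right (hb (s • z) t ht) (hpos 0 t z ht)
    rw [h2] at h1
    linarith
  have hmono : Monotone (fun s : ℝ => 2 * ⟪z, N (φ (s • z))⟫ - s * c) :=
    monotone_of_deriv_nonneg (fun s => (hder s).differentiableAt)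
      (fun s => by rw [(hder s).deriv]; exact hnonneg s)
  have h01 := hmono (zero_le_one' ℝ)
  simp only [zero_smul, hφ0, map_zero, inner_zero_right, one_smul] at h01
  linarith

end Metric

namespace Design
variable {n : ℕ} {d : Design n} {R : Robot n}

lemma MetricInequality.free {err : State n → State n → ℝ → Vec n} {P : Vec n → ℝ → Mat n}
    {φ : Vec n → Vec n} {β : Vec n → ℝ → ℝ} (h : MetricInequality R err P φ β)
    (hP : ContDiff ℝ ∞ (fun z : Vec n × ℝ => P z.1 z.2))
    (he : ContDiff ℝ ∞ (fun y : State n × State n × ℝ => err y.1 y.2.1 y.2.2))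
    (hsurj : ∀ z w t, ∃ xv x, err xv x t = z ∧ R.totalDeriv err xv x t = w) :
    FreeMetricInequality P φ β := by
  intro z w t ht v
  obtain ⟨xv, x, rfl, rfl⟩ := hsurj z w t
  have := h xv x t ht v
  simp only at this
  rwa [R.totalDeriv_comp (hP.differentiable (by simp)) (he.differentiable (by simp) _)] at this

/-- The virtual link momentum is free, so every link error velocity occurs. -/
lemma Admissible.free_metric_ineq_l (hd : d.Admissible R) :
    FreeMetricInequality d.PiL d.φl d.βl := by
  refine hd.metric_ineq_l.free hd.smooth_PiL hd.contDiff_errL fun z w t => ?_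
  refine ⟨((z + d.qld t, 0), (R.Ml 0 (w + deriv d.qld t), 0)), 0, by simp [errL, ql], ?_⟩
  have hq : Differentiable ℝ d.qld := hd.smooth_qld.differentiable (by simp)
  let L : State n →L[ℝ] Vec n := ContinuousLinearMap.fst ℝ _ _ ∘L ContinuousLinearMap.fst ℝ _ _
  have h := R.totalDeriv_sub (g := fun yv _ _ => L yv) (h := fun _ _ s => d.qld s)
    (xv := ((z + d.qld t, 0), (R.Ml 0 (w + deriv d.qld t), 0))) (x := 0) (t := t)
    (by fun_prop) (by fun_prop)
  refine (Eq.trans ?_ h).trans ?_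
  · rfl
  rw [R.totalDeriv_linear, R.totalDeriv_time (hq t), R.virtualField_eq]
  change R.MlInv 0 (R.Ml 0 (w + deriv d.qld t)) - _ = w
  rw [R.MlInv_Ml, add_sub_cancel_right]

/-- The virtual motor momentum is free, and the motor reference does not depend on it, so every
motor error velocity occurs. -/
lemma Admissible.free_metric_ineq_m (hd : d.Admissible R) :
    FreeMetricInequality d.PiM d.φm d.βm := by
  refine hd.metric_ineq_m.free hd.smooth_PiM hd.contDiff_errM fun z w t => ?_
  set q : Vec n := z + d.qmd R 0 0 t with hq
  set r : Vec n := R.totalDeriv (d.qmd R) ((0, q), (0, 0)) 0 t with hr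
  have h1 : d.qmd R ((0, q), (0, R.Mm 0 (w + r))) 0 t = d.qmd R 0 0 t :=
    hd.dependsOn_qmd _ _ _ _ _ rfl rfl
  have h2 : R.totalDeriv (d.qmd R) ((0, q), (0, R.Mm 0 (w + r))) 0 t = r :=
    hd.dependsOn_totalDeriv_qmd _ _ _ _ _ rfl rfl
  refine ⟨((0, q), (0, R.Mm 0 (w + r))), 0, ?_, ?_⟩
  · rw [errM, h1]
    simp [qm, hq]
  let L : State n →L[ℝ] Vec n := ContinuousLinearMap.snd ℝ _ _ ∘L ContinuousLinearMap.fst ℝ _ _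
  have h := R.totalDeriv_sub (g := fun yv _ _ => L yv) (h := d.qmd R)
    (xv := ((0, q), (0, R.Mm 0 (w + r)))) (x := 0) (t := t)
    (by fun_prop) (hd.contDiff_qmd.differentiable (by simp) _)
  refine (Eq.trans ?_ h).trans ?_
  · rfl
  rw [R.totalDeriv_linear, h2, R.virtualField_eq]
  change R.MmInv 0 (R.Mm 0 (w + r)) - r = w
  rw [R.MmInv_Mm, add_sub_cancel_right]

end Design

/-! ### The decay rate -/

lemma isSelfAdjoint_add {n : ℕ} {A B : Mat n} (hA : IsSelfAdjoint A) (hB : IsSelfAdjoint B) :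
    IsSelfAdjoint (A + B) := by
  rw [ContinuousLinearMap.isSelfAdjoint_iff_isSymmetric] at *
  exact hA.add hB

namespace Design
variable {n : ℕ} {d : Design n} {R : Robot n}

lemma Admissible.lambdaDamping_spec (hd : d.Admissible R) (hn : 0 < n) :
    0 < d.lambdaDamping R ∧
    (∀ q v, d.lambdaDamping R * ‖v‖ ^ 2 ≤ ⟪v, (R.Dl q + d.Kld) v⟫) ∧
    (∀ q v, d.lambdaDamping R * ‖v‖ ^ 2 ≤ ⟪v, (R.Dm q + d.Kmd) v⟫) := by
  obtain ⟨a, ha, hal⟩ := hd.posDef_Kld.exists_le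
  obtain ⟨b, hb, hbm⟩ := hd.posDef_Kmd.exists_le
  have h := iInf_lambdaMin_prodMap_spec (ι := Vec n × Vec n) (A := fun q => R.Dl q.1 + d.Kld)
    (B := fun q => R.Dm q.2 + d.Kmd) (c := min a b) hn
    (fun q => isSelfAdjoint_add (R.posSemidef_Dl q.1).1 hd.posDef_Kld.1)
    (fun q => isSelfAdjoint_add (R.posSemidef_Dm q.2).1 hd.posDef_Kmd.1)
    (fun q v => by
      have h1 := (R.posSemidef_Dl q.1).2 v
      have h2 := mul_le_mul_of_nonneg_right (min_le_left a b) (sq_nonneg ‖v‖)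
      rw [add_apply, inner_add_right]
      linarith [hal v])
    (fun q v => by
      have h1 := (R.posSemidef_Dm q.2).2 v
      have h2 := mul_le_mul_of_nonneg_right (min_le_right a b) (sq_nonneg ‖v‖)
      rw [add_apply, inner_add_right]
      linarith [hbm v])
  exact ⟨lt_of_lt_of_le (lt_min ha hb) h.1, fun q v => (h.2 (q, 0) v).1,
    fun q v => (h.2 (0, q) v).2⟩

lemma Admissible.lambdaInvInertia_spec (hd : d.Admissible R) (hn : 0 < n) :
    0 < lambdaInvInertia R ∧
    (∀ q v, lambdaInvInertia R * ‖v‖ ^ 2 ≤ ⟪v, R.MlInv q v⟫) ∧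
    (∀ q v, lambdaInvInertia R * ‖v‖ ^ 2 ≤ ⟪v, R.MmInv q v⟫) := by
  obtain ⟨c₁, c₂, hc, hu⟩ := hd.uniform_metric
  have h := iInf_lambdaMin_prodMap_spec (ι := Vec n × Vec n) (A := fun q => R.MlInv q.1)
    (B := fun q => R.MmInv q.2) (c := c₁) hn (fun q => R.isSelfAdjoint_MlInv q.1)
    (fun q => R.isSelfAdjoint_MmInv q.2) (fun q v => ((hu v).2.2.1 q.1).1)
    (fun q v => ((hu v).2.2.2 q.2).1)
  exact ⟨lt_of_lt_of_le hc h.1, fun q v => (h.2 (q, 0) v).1, fun q v => (h.2 (0, q) v).2⟩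

lemma iInf_beta_spec {β : Vec n → ℝ → ℝ} (h : ∃ b : ℝ, 0 < b ∧ ∀ z t, 0 ≤ t → b ≤ β z t) :
    0 < (⨅ z : Vec n × ℝ≥0, β z.1 z.2) ∧
      ∀ z t, 0 ≤ t → (⨅ z : Vec n × ℝ≥0, β z.1 z.2) ≤ β z t := by
  obtain ⟨b, hb, hle⟩ := h
  refine ⟨lt_of_lt_of_le hb (le_ciInf fun z => hle z.1 z.2 z.2.2), fun z t ht => ?_⟩
  exact ciInf_le (f := fun z : Vec n × ℝ≥0 => β z.1 z.2)
    ⟨b, by rintro _ ⟨y, rfl⟩; exact hle y.1 y.2 y.2.2⟩ (z, ⟨t, ht⟩)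

lemma Admissible.rate_pos (hd : d.Admissible R) (hn : 0 < n) : 0 < d.rate R :=
  lt_min (lt_min (iInf_beta_spec hd.uniform_βl).1 (iInf_beta_spec hd.uniform_βm).1)
    (mul_pos (hd.lambdaDamping_spec hn).1 (hd.lambdaInvInertia_spec hn).1)

lemma Admissible.rate_le_βl (hd : d.Admissible R) (z : Vec n) (t : ℝ) (ht : 0 ≤ t) :
    d.rate R ≤ d.βl z t :=
  ((min_le_left _ _).trans (min_le_left _ _)).trans ((iInf_beta_spec hd.uniform_βl).2 z t ht)

lemma Admissible.rate_le_βm (hd : d.Admissible R) (z : Vec n) (t : ℝ) (ht : 0 ≤ t) :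
    d.rate R ≤ d.βm z t :=
  ((min_le_left _ _).trans (min_le_right _ _)).trans ((iInf_beta_spec hd.uniform_βm).2 z t ht)

lemma Admissible.rate_mul_inner_le_l (hd : d.Admissible R) (hn : 0 < n) (q v : Vec n) :
    d.rate R * ⟪v, R.MlInv q v⟫ ≤ ⟪R.MlInv q v, (R.Dl q + d.Kld) (R.MlInv q v)⟫ := by
  obtain ⟨h1, h1', -⟩ := hd.lambdaDamping_spec hn
  obtain ⟨h2, h2', -⟩ := hd.lambdaInvInertia_spec hn
  have h3 := mul_inner_le_norm_apply_sq h2 (h2' q v)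
  have h4 : 0 ≤ ⟪v, R.MlInv q v⟫ := le_trans (by positivity) (h2' q v)
  calc d.rate R * ⟪v, R.MlInv q v⟫
      ≤ (d.lambdaDamping R * lambdaInvInertia R) * ⟪v, R.MlInv q v⟫ :=
        mul_le_mul_of_nonneg_right (min_le_right _ _) h4
    _ = d.lambdaDamping R * (lambdaInvInertia R * ⟪v, R.MlInv q v⟫) := by ring
    _ ≤ d.lambdaDamping R * ‖R.MlInv q v‖ ^ 2 := by gcongr
    _ ≤ _ := h1' q _

lemma Admissible.rate_mul_inner_le_m (hd : d.Admissible R) (hn : 0 < n) (q v : Vec n) :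
    d.rate R * ⟪v, R.MmInv q v⟫ ≤ ⟪R.MmInv q v, (R.Dm q + d.Kmd) (R.MmInv q v)⟫ := by
  obtain ⟨h1, -, h1'⟩ := hd.lambdaDamping_spec hn
  obtain ⟨h2, -, h2'⟩ := hd.lambdaInvInertia_spec hn
  have h3 := mul_inner_le_norm_apply_sq h2 (h2' q v)
  have h4 : 0 ≤ ⟪v, R.MmInv q v⟫ := le_trans (by positivity) (h2' q v)
  calc d.rate R * ⟪v, R.MmInv q v⟫
      ≤ (d.lambdaDamping R * lambdaInvInertia R) * ⟪v, R.MmInv q v⟫ :=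
        mul_le_mul_of_nonneg_right (min_le_right _ _) h4
    _ = d.lambdaDamping R * (lambdaInvInertia R * ⟪v, R.MmInv q v⟫) := by ring
    _ ≤ d.lambdaDamping R * ‖R.MmInv q v‖ ^ 2 := by gcongr
    _ ≤ _ := h1' q _

/-! ### Error dynamics of the closed loop -/

section Solution
variable {x : ℝ → State n} {J : Set ℝ} {t : ℝ} {u : Vec n}

lemma hasDerivWithinAt_ql (hx : HasDerivWithinAt x (R.field (x t) u) J t) :
    HasDerivWithinAt (fun s => ql (x s)) (R.MlInv (ql (x t)) (pl (x t))) J t := by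
  rw [R.field_eq, R.virtualField_eq] at hx
  exact hx.fst.fst

lemma hasDerivWithinAt_qm (hx : HasDerivWithinAt x (R.field (x t) u) J t) :
    HasDerivWithinAt (fun s => qm (x s)) (R.MmInv (qm (x t)) (pm (x t))) J t := by
  rw [R.field_eq, R.virtualField_eq] at hx
  exact hx.fst.snd

lemma hasDerivWithinAt_pl (hx : HasDerivWithinAt x (R.field (x t) u) J t) :
    HasDerivWithinAt (fun s => pl (x s)) (-(∇ R.Pl (ql (x t)) + -R.K (qm (x t) - ql (x t)))
      - (R.El (x t) + R.Dl (ql (x t))) (R.MlInv (ql (x t)) (pl (x t)))) J t := by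
  rw [R.field_eq, R.virtualField_eq] at hx
  exact hx.snd.fst

lemma hasDerivWithinAt_pm (hx : HasDerivWithinAt x (R.field (x t) u) J t) :
    HasDerivWithinAt (fun s => pm (x s)) (-R.K (qm (x t) - ql (x t))
      - (R.Em (x t) + R.Dm (qm (x t))) (R.MmInv (qm (x t)) (pm (x t)))
      + R.Bm (qm (x t)) u) J t := by
  rw [R.field_eq, R.virtualField_eq] at hx
  exact hx.snd.snd

lemma Admissible.PiL_eq (hd : d.Admissible R) (z : Vec n) (t : ℝ) (ht : 0 ≤ t) :
    d.PiL z t = d.PiL 0 t :=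
  hd.free_metric_ineq_l.eq_zero_pos hd.smooth_PiL hd.selfAdjoint_PiL z ht

lemma Admissible.PiM_eq (hd : d.Admissible R) (z : Vec n) (t : ℝ) (ht : 0 ≤ t) :
    d.PiM z t = d.PiM 0 t :=
  hd.free_metric_ineq_m.eq_zero_pos hd.smooth_PiM hd.selfAdjoint_PiM z ht

lemma Admissible.hasDerivWithinAt_errL (hd : d.Admissible R)
    (hx : HasDerivWithinAt x (R.field (x t) u) J t) :
    HasDerivWithinAt (fun s => d.errL (x s) (x s) s)
      (R.MlInv (ql (x t)) (d.sigmaL R (x t) (x t) t) - d.φl (d.errL (x t) (x t) t)) J t := by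
  have h1 := hasDerivWithinAt_ql hx
  have h2 := (hd.smooth_qld.differentiable (by simp) t).hasDerivAt.hasDerivWithinAt (s := J)
  refine (h1.fun_sub h2).congr_deriv ?_
  rw [sigmaL, plr, map_sub, R.MlInv_Ml]
  abel

lemma Admissible.hasDerivWithinAt_sigmaL (hd : d.Admissible R) (ht : 0 ≤ t)
    (hx : HasDerivWithinAt x (R.field (x t) u) J t) :
    HasDerivWithinAt (fun s => d.sigmaL R (x s) (x s) s)
      (R.K (d.errM R (x t) (x t) t)
        - (R.El (x t) + R.Dl (ql (x t)) + d.Kld)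
            (R.MlInv (ql (x t)) (d.sigmaL R (x t) (x t) t))
        - d.PiL 0 t (d.errL (x t) (x t) t)) J t := by
  have h1 := hasDerivWithinAt_pl hx
  have hdep : DependsOn withoutMotorMomenta (d.plr R) :=
    (d.dependsOn_plr R).mono fun y y' h => by
      simp only [withoutMotorMomenta_apply, Prod.mk.injEq] at h
      simp only [linkPos_apply, h]
  have h2 := hdep.hasDerivWithinAt R (hd.contDiff_plr.differentiable (by simp) _) hx
  refine (h1.fun_sub h2).congr_deriv ?_
  have h3 : R.K (qm (x t) - ql (x t)) =
      R.K (d.errM R (x t) (x t) t) + d.ul R (x t) (x t) t := by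
    have h : qm (x t) - ql (x t) =
        d.errM R (x t) (x t) t + R.K.inverse (d.ul R (x t) (x t) t) := by
      rw [errM, qmd]
      abel
    rw [h, map_add, R.K_inverse]
  have h4 : pl (x t) = d.sigmaL R (x t) (x t) t + d.plr R (x t) (x t) t := by
    rw [sigmaL]; abel
  rw [h3, h4, ul, metricIntegral_eq (fun z t ht => hd.PiL_eq z t ht) _ ht]
  simp only [map_add, add_apply]
  abel

lemma Admissible.hasDerivWithinAt_errM (hd : d.Admissible R) (ht : 0 ≤ t)
    (hx : HasDerivWithinAt x (R.field (x t) u) J t) :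
    HasDerivWithinAt (fun s => d.errM R (x s) (x s) s)
      (R.MmInv (qm (x t)) (d.sigmaM R (x t) (x t) t) - d.φm (d.errM R (x t) (x t) t)
        - (d.PiM 0 t).inverse (ContinuousLinearMap.adjoint R.K
            (R.MlInv (ql (x t)) (d.sigmaL R (x t) (x t) t)))) J t := by
  have h1 := hasDerivWithinAt_qm hx
  have hdep : DependsOn withoutMotorMomenta (d.qmd R) :=
    hd.dependsOn_qmd.mono fun y y' h => by
      simp only [withoutMotorMomenta_apply, Prod.mk.injEq] at h
      simp only [linkState_apply, h]
  have h2 := hdep.hasDerivWithinAt R (hd.contDiff_qmd.differentiable (by simp) _) hx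
  refine (h1.fun_sub h2).congr_deriv ?_
  rw [sigmaM, pmr, map_sub, R.MmInv_Mm, hd.PiM_eq _ t ht]
  abel

lemma Admissible.hasDerivWithinAt_sigmaM (hd : d.Admissible R) (ht : 0 ≤ t)
    (hx : HasDerivWithinAt x (R.field (x t) (d.control R (x t) (x t) t)) J t) :
    HasDerivWithinAt (fun s => d.sigmaM R (x s) (x s) s)
      (-(R.Em (x t) + R.Dm (qm (x t)) + d.Kmd)
            (R.MmInv (qm (x t)) (d.sigmaM R (x t) (x t) t))
        - d.PiM 0 t (d.errM R (x t) (x t) t)) J t := by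
  have h1 := hasDerivWithinAt_pm hx
  have h2 := hd.dependsOn_pmr.hasDerivWithinAt R
    ((hd.contDiffAt_pmr (x t) (x t) ht).differentiableAt (by simp)) hx
  refine (h1.fun_sub h2).congr_deriv ?_
  have h4 : pm (x t) = d.sigmaM R (x t) (x t) t + d.pmr R (x t) (x t) t := by
    rw [sigmaM]; abel
  rw [control, R.Bm_inverse, h4, metricIntegral_eq (fun z t ht => hd.PiM_eq z t ht) _ ht]
  simp only [map_add, add_apply]
  abel

end Solution

/-! ### The storage function -/

section Quadratic
variable {J : Set ℝ} {t : ℝ}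

lemma hasDerivWithinAt_inner_metric {N : ℝ → Mat n} {e : ℝ → Vec n} {N' : Mat n} {e' : Vec n}
    (hsa : IsSelfAdjoint (N t)) (hN : HasDerivWithinAt N N' J t) (he : HasDerivWithinAt e e' J t) :
    HasDerivWithinAt (fun s => ⟪e s, N s (e s)⟫) (2 * ⟪e t, N t e'⟫ + ⟪e t, N' (e t)⟫) J t := by
  refine (he.inner ℝ (hN.clm_apply he)).congr_deriv ?_
  have h : ⟪e', N t (e t)⟫ = ⟪e t, N t e'⟫ := by
    rw [← inner_apply_comm hsa, real_inner_comm]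
  rw [inner_add_right, h]
  ring

/-- Derivative of the inverse, from `M(q) M(q)⁻¹ v = v`. -/
lemma apply_fderiv_inverse {M : Vec n → Mat n} (hM : ContDiff ℝ ∞ M) (hpd : ∀ q, PosDef (M q))
    (q h v : Vec n) : M q (fderiv ℝ (fun y => (M y).inverse) q h v) =
      -fderiv ℝ M q h ((M q).inverse v) := by
  have hM' : DifferentiableAt ℝ (fun y => (M y).inverse) q :=
    (contDiffAt_inverse hM.contDiffAt (hpd q).isInvertible).differentiableAt (by simp)
  have h1 := (hM.differentiable (by simp) q).hasFDerivAt.clm_apply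
    (hM'.hasFDerivAt.clm_apply (hasFDerivAt_const v q))
  have h2 : (fun y => M y ((M y).inverse v)) = fun _ => v :=
    funext fun y => IsInvertible.apply_inverse (hpd y).isInvertible v
  rw [h2] at h1
  have h3 := congrArg (fun A : Vec n →L[ℝ] Vec n => A h) (h1.unique (hasFDerivAt_const v q))
  simp at h3
  rw [eq_neg_iff_add_eq_zero]
  exact h3

/-- Derivative of the kinetic energy `σᵀ M(q)⁻¹ σ` along `q̇ = M(q)⁻¹ p`. -/
lemma hasDerivWithinAt_inner_inertia {M : Vec n → Mat n} (hM : ContDiff ℝ ∞ M)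
    (hpd : ∀ q, PosDef (M q)) {q σ : ℝ → Vec n} {p σ' : Vec n}
    (hq : HasDerivWithinAt q ((M (q t)).inverse p) J t) (hσ : HasDerivWithinAt σ σ' J t) :
    HasDerivWithinAt (fun s => ⟪σ s, (M (q s)).inverse (σ s)⟫)
      (2 * ⟪(M (q t)).inverse (σ t), σ'⟫ - ⟪(M (q t)).inverse (σ t),
        inertiaRate M (q t) p ((M (q t)).inverse (σ t))⟫) J t := by
  have hM' : DifferentiableAt ℝ (fun y => (M y).inverse) (q t) :=
    (contDiffAt_inverse hM.contDiffAt (hpd _).isInvertible).differentiableAt (by simp)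
  have h1 := hM'.hasFDerivAt.comp_hasDerivWithinAt t hq
  have hsa := isSelfAdjoint_inverse (hpd (q t))
  refine (hasDerivWithinAt_inner_metric (N := fun s => (M (q s)).inverse) hsa h1 hσ).congr_deriv ?_
  set w := (M (q t)).inverse (σ t) with hw
  have h2 : ⟪σ t, (M (q t)).inverse σ'⟫ = ⟪w, σ'⟫ := (inner_apply_comm hsa _ _).symm
  have h3 : σ t = M (q t) w := (IsInvertible.apply_inverse (hpd _).isInvertible _).symm
  have h4 : ⟪σ t, fderiv ℝ (fun y => (M y).inverse) (q t) ((M (q t)).inverse p) (σ t)⟫ =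
      -⟪w, inertiaRate M (q t) p w⟫ := by
    conv_lhs => rw [h3, inner_apply_comm (hpd _).1, apply_fderiv_inverse hM hpd, ← h3]
    rw [inner_neg_right]
    rfl
  rw [h2, h4]
  ring

end Quadratic

/-- Twice the storage function, `x̃ᵀ diag(Π_ℓ, Π_m, M_ℓ⁻¹, M_m⁻¹) x̃`, at `x_v = x`. -/
def storage (d : Design n) (R : Robot n) (x : State n) (t : ℝ) : ℝ :=
  ⟪d.errL x x t, d.PiL 0 t (d.errL x x t)⟫ + ⟪d.errM R x x t, d.PiM 0 t (d.errM R x x t)⟫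
    + ⟪d.sigmaL R x x t, R.MlInv (ql x) (d.sigmaL R x x t)⟫
    + ⟪d.sigmaM R x x t, R.MmInv (qm x) (d.sigmaM R x x t)⟫

lemma inner_skew_eq_zero {S : Mat n} (h : ContinuousLinearMap.adjoint S = -S) (v : Vec n) :
    ⟪v, S v⟫ = 0 := by
  have h1 := ContinuousLinearMap.adjoint_inner_left S v v
  rw [h, neg_apply, inner_neg_left, real_inner_comm] at h1
  linarith

/-- Along the closed loop the skew-symmetric forces, the inertia rates and the couplings between
positions and momenta and between links and motors cancel, and the storage function decays. -/
lemma Admissible.exists_hasDerivWithinAt_storage (hd : d.Admissible R) (hn : 0 < n)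
    {x : ℝ → State n} {J : Set ℝ} {t : ℝ} (ht : 0 ≤ t)
    (hx : HasDerivWithinAt x (R.field (x t) (d.control R (x t) (x t) t)) J t) :
    ∃ V' : ℝ, HasDerivWithinAt (fun s => d.storage R (x s) s) V' J t ∧
      V' ≤ -2 * d.rate R * d.storage R (x t) t := by
  obtain ⟨c₁, c₂, hc, hu⟩ := hd.uniform_metric
  have hNl := (hasDerivAt_metric hd.smooth_PiL 0 t).differentiableAt.hasDerivAt.hasDerivWithinAt
    (s := J)
  have hNm := (hasDerivAt_metric hd.smooth_PiM 0 t).differentiableAt.hasDerivAt.hasDerivWithinAt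
    (s := J)
  have h1 := hasDerivWithinAt_inner_metric (hd.selfAdjoint_PiL 0 t ht) hNl
    (hd.hasDerivWithinAt_errL hx)
  have h2 := hasDerivWithinAt_inner_metric (hd.selfAdjoint_PiM 0 t ht) hNm
    (hd.hasDerivWithinAt_errM ht hx)
  have h3 := hasDerivWithinAt_inner_inertia R.smooth_Ml R.posDef_Ml (hasDerivWithinAt_ql hx)
    (hd.hasDerivWithinAt_sigmaL ht hx)
  have h4 := hasDerivWithinAt_inner_inertia R.smooth_Mm R.posDef_Mm (hasDerivWithinAt_qm hx)
    (hd.hasDerivWithinAt_sigmaM ht hx)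
  refine ⟨_, ((h1.fun_add h2).fun_add h3).fun_add h4, ?_⟩
  have k1 := hd.free_metric_ineq_l.integrated hd.smooth_PiL hd.selfAdjoint_PiL
    (hd.smooth_φl.differentiable (by simp)) hd.φl_zero hd.rate_le_βl
    (fun z t v ht => le_trans (by positivity) ((hu v).1 z t ht).1) (d.errL (x t) (x t) t) ht
  have k2 := hd.free_metric_ineq_m.integrated hd.smooth_PiM hd.selfAdjoint_PiM
    (hd.smooth_φm.differentiable (by simp)) hd.φm_zero hd.rate_le_βm
    (fun z t v ht => le_trans (by positivity) ((hu v).2.1 z t ht).1) (d.errM R (x t) (x t) t) ht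
  have k3 := hd.rate_mul_inner_le_l hn (ql (x t)) (d.sigmaL R (x t) (x t) t)
  have k4 := hd.rate_mul_inner_le_m hn (qm (x t)) (d.sigmaM R (x t) (x t) t)
  unfold storage
  change _ + (2 * ⟪R.MlInv (ql (x t)) (d.sigmaL R (x t) (x t) t), _⟫ -
      ⟪R.MlInv (ql (x t)) (d.sigmaL R (x t) (x t) t), inertiaRate R.Ml (ql (x t)) (pl (x t))
        (R.MlInv (ql (x t)) (d.sigmaL R (x t) (x t) t))⟫) +
    (2 * ⟪R.MmInv (qm (x t)) (d.sigmaM R (x t) (x t) t), _⟫ -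
      ⟪R.MmInv (qm (x t)) (d.sigmaM R (x t) (x t) t), inertiaRate R.Mm (qm (x t)) (pm (x t))
        (R.MmInv (qm (x t)) (d.sigmaM R (x t) (x t) t))⟫) ≤ _
  set sl := d.sigmaL R (x t) (x t) t
  set sm := d.sigmaM R (x t) (x t) t
  set el := d.errL (x t) (x t) t
  set em := d.errM R (x t) (x t) t
  set wl := R.MlInv (ql (x t)) sl
  set wm := R.MmInv (qm (x t)) sm
  have j1 := inner_skew_eq_zero (R.gyroscopic_Sl.1 (ql (x t)) (pl (x t))) wl
  have j2 := inner_skew_eq_zero (R.gyroscopic_Sm.1 (qm (x t)) (pm (x t))) wm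
  have j3 : d.PiM 0 t ((d.PiM 0 t).inverse (ContinuousLinearMap.adjoint R.K wl)) =
      ContinuousLinearMap.adjoint R.K wl :=
    IsInvertible.apply_inverse (hd.isInvertible_PiM 0 ht) _
  have j4 : ⟪em, ContinuousLinearMap.adjoint R.K wl⟫ = ⟪wl, R.K em⟫ := by
    rw [ContinuousLinearMap.adjoint_inner_right, real_inner_comm]
  have j5 : ⟪wl, d.PiL 0 t el⟫ = ⟪el, d.PiL 0 t wl⟫ := by
    rw [← inner_apply_comm (hd.selfAdjoint_PiL 0 t ht), real_inner_comm]
  have j6 : ⟪wm, d.PiM 0 t em⟫ = ⟪em, d.PiM 0 t wm⟫ := by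
    rw [← inner_apply_comm (hd.selfAdjoint_PiM 0 t ht), real_inner_comm]
  simp only [map_sub, inner_sub_right, inner_add_right, add_apply, sub_apply, smul_apply,
    inner_neg_right, inner_smul_right, Robot.El, Robot.Em, j1, j2, j3, j4, j5, j6]
    at k1 k2 k3 k4 ⊢
  linarith

/-! ### Exponential decay of the error -/

lemma le_exp_mul_of_hasDerivWithinAt_le {V : ℝ → ℝ} {b t₀ t : ℝ} (htt : t₀ ≤ t) {J : Set ℝ}
    (hJ : Set.Icc t₀ t ⊆ J)
    (hV : ∀ s ∈ J, ∃ V' : ℝ, HasDerivWithinAt V V' J s ∧ V' ≤ -2 * b * V s) :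
    V t ≤ Real.exp (-2 * b * (t - t₀)) * V t₀ := by
  choose! V' hV' hle using hV
  -- `J` need not be a neighbourhood of its points, so derivatives are taken within `[t₀, t]`
  have hder : ∀ s ∈ Set.Icc t₀ t, HasDerivWithinAt (fun s => Real.exp (2 * b * (s - t₀)) * V s)
      (Real.exp (2 * b * (s - t₀)) * (2 * b) * V s + Real.exp (2 * b * (s - t₀)) * V' s)
      (Set.Icc t₀ t) s := by
    intro s hs
    have h1 : HasDerivAt (fun s => Real.exp (2 * b * (s - t₀)))
        (Real.exp (2 * b * (s - t₀)) * (2 * b)) s := by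
      have := (((hasDerivAt_id s).sub_const t₀).const_mul (2 * b)).exp
      simpa using this
    exact h1.hasDerivWithinAt.mul ((hV' s (hJ hs)).mono hJ)
  have hanti := antitoneOn_of_hasDerivWithinAt_nonpos (convex_Icc t₀ t)
    (fun s hs => (hder s hs).continuousWithinAt)
    (fun s hs => (hder s (interior_subset hs)).mono interior_subset) (fun s hs => by
      have h1 := hle s (hJ (interior_subset hs))
      have h2 : 0 < Real.exp (2 * b * (s - t₀)) := Real.exp_pos _
      nlinarith)
  have h := hanti (Set.left_mem_Icc.2 htt) (Set.right_mem_Icc.2 htt) htt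
  simp only [sub_self, mul_zero, Real.exp_zero, one_mul] at h
  have h2 : Real.exp (-2 * b * (t - t₀)) * Real.exp (2 * b * (t - t₀)) = 1 := by
    rw [← Real.exp_add]
    simp
  calc V t = Real.exp (-2 * b * (t - t₀)) * (Real.exp (2 * b * (t - t₀)) * V t) := by
        rw [← mul_assoc, h2, one_mul]
    _ ≤ _ := by gcongr

lemma norm_sq_le_storage {c₁ : ℝ} (hc : 0 < c₁) {a b c e : Vec n} {x y z w : ℝ}
    (h1 : c₁ * ‖a‖ ^ 2 ≤ x) (h2 : c₁ * ‖b‖ ^ 2 ≤ y) (h3 : c₁ * ‖c‖ ^ 2 ≤ z)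
    (h4 : c₁ * ‖e‖ ^ 2 ≤ w) : c₁ * ‖(((a, b), (c, e)) : State n)‖ ^ 2 ≤ x + y + z + w := by
  have g : ∀ v : Vec n, 0 ≤ c₁ * ‖v‖ ^ 2 := fun v => by positivity
  have := g a; have := g b; have := g c; have := g e
  simp only [Prod.norm_def]
  rcases max_choice (max ‖a‖ ‖b‖) (max ‖c‖ ‖e‖) with h | h <;> rw [h]
  · rcases max_choice ‖a‖ ‖b‖ with h' | h' <;> rw [h'] <;> linarith
  · rcases max_choice ‖c‖ ‖e‖ with h' | h' <;> rw [h'] <;> linarith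

/-- The error decays exponentially, with an overshoot that depends on the bounds of the metric
only. -/
theorem Admissible.exists_norm_error_le (hd : d.Admissible R) (hn : 0 < n) :
    ∃ C : ℝ, 0 ≤ C ∧ ∀ (t₀ : ℝ) (J : Set ℝ) (x : ℝ → State n),
      0 ≤ t₀ → t₀ ∈ J → J ⊆ Set.Ici t₀ → J.OrdConnected → d.IsClosedLoopSolution R J x →
      ∀ t ∈ J, ‖d.error R (x t) t‖ ≤
        C * Real.exp (-(d.rate R) * (t - t₀)) * ‖d.error R (x t₀) t₀‖ := by
  obtain ⟨c₁, c₂, hc, hu⟩ := hd.uniform_metric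
  -- the sign of `c₂` comes from a nonzero vector, which exists as `n > 0`
  have hc₂ : 0 ≤ c₂ := by
    have : Nonempty (Fin n) := ⟨⟨0, hn⟩⟩
    obtain ⟨v, hv⟩ := exists_ne (0 : Vec n)
    have h := (hu v).2.2.1 0
    have h' : 0 < ‖v‖ ^ 2 := by have := norm_pos_iff.2 hv; positivity
    have := h.1.trans h.2
    have := le_of_mul_le_mul_right this h'
    linarith
  -- the factor 4 counts the blocks of the error, whose norm is the maximum over the blocks
  refine ⟨Real.sqrt (4 * c₂ / c₁), Real.sqrt_nonneg _,
    fun t₀ J x ht₀ hmem hsub hord hsol t ht => ?_⟩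
  have htt : t₀ ≤ t := hsub ht
  have hV := le_exp_mul_of_hasDerivWithinAt_le (V := fun s => d.storage R (x s) s)
    (b := d.rate R) htt (hord.out hmem ht)
    (fun s hs => hd.exists_hasDerivWithinAt_storage hn (ht₀.trans (hsub hs)) (hsol s hs))
  have hlow : c₁ * ‖d.error R (x t) t‖ ^ 2 ≤ d.storage R (x t) t :=
    norm_sq_le_storage hc ((hu _).1 0 t (ht₀.trans htt)).1 ((hu _).2.1 0 t (ht₀.trans htt)).1
      ((hu _).2.2.1 _).1 ((hu _).2.2.2 _).1
  have hupp : d.storage R (x t₀) t₀ ≤ 4 * c₂ * ‖d.error R (x t₀) t₀‖ ^ 2 := by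
    have g : ∀ v : Vec n, ‖v‖ ≤ ‖d.error R (x t₀) t₀‖ →
        c₂ * ‖v‖ ^ 2 ≤ c₂ * ‖d.error R (x t₀) t₀‖ ^ 2 := fun v hv => by gcongr
    have e1 := g (d.errL (x t₀) (x t₀) t₀)
      ((norm_fst_le (d.error R (x t₀) t₀).1).trans (norm_fst_le _))
    have e2 := g (d.errM R (x t₀) (x t₀) t₀)
      ((norm_snd_le (d.error R (x t₀) t₀).1).trans (norm_fst_le _))
    have e3 := g (d.sigmaL R (x t₀) (x t₀) t₀)
      ((norm_fst_le (d.error R (x t₀) t₀).2).trans (norm_snd_le _))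
    have e4 := g (d.sigmaM R (x t₀) (x t₀) t₀)
      ((norm_snd_le (d.error R (x t₀) t₀).2).trans (norm_snd_le _))
    have f1 := ((hu (d.errL (x t₀) (x t₀) t₀)).1 0 t₀ ht₀).2
    have f2 := ((hu (d.errM R (x t₀) (x t₀) t₀)).2.1 0 t₀ ht₀).2
    have f3 := ((hu (d.sigmaL R (x t₀) (x t₀) t₀)).2.2.1 (ql (x t₀))).2
    have f4 := ((hu (d.sigmaM R (x t₀) (x t₀) t₀)).2.2.2 (qm (x t₀))).2
    unfold storage
    linarith
  have hsq : ‖d.error R (x t) t‖ ^ 2 ≤ (Real.sqrt (4 * c₂ / c₁) *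
      Real.exp (-(d.rate R) * (t - t₀)) * ‖d.error R (x t₀) t₀‖) ^ 2 := by
    have hexp : Real.exp (-2 * d.rate R * (t - t₀)) = Real.exp (-(d.rate R) * (t - t₀)) ^ 2 := by
      rw [sq, ← Real.exp_add]
      congr 1
      ring
    rw [mul_pow, mul_pow, Real.sq_sqrt (by positivity), ← hexp, div_mul_eq_mul_div,
      div_mul_eq_mul_div, le_div_iff₀ hc]
    have := mul_le_mul_of_nonneg_left hupp (Real.exp_pos (-2 * d.rate R * (t - t₀))).le
    linarith
  exact le_of_sq_le_sq hsq (by positivity)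

end Design

/-! ### Bounds on balls -/

section Bounds
variable {E F : Type} [NormedAddCommGroup E] [NormedSpace ℝ E] [FiniteDimensional ℝ E]
  [NormedAddCommGroup F]

lemma exists_norm_le_on_ball {f : E → F} (hf : Continuous f) (r : ℝ) :
    ∃ B : ℝ, 0 ≤ B ∧ ∀ x, ‖x‖ ≤ r → ‖f x‖ ≤ B := by
  have : ProperSpace E := FiniteDimensional.proper ℝ E
  obtain ⟨B, hB⟩ := (isCompact_closedBall (0 : E) r).exists_bound_of_continuousOn hf.continuousOn
  exact ⟨max B 0, le_max_right _ _, fun x hx => (hB x (by simpa using hx)).trans (le_max_left _ _)⟩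

lemma exists_lipschitz_on_ball [NormedSpace ℝ F] {f : E → F} (hf : ContDiff ℝ ∞ f) (r : ℝ) :
    ∃ L : ℝ, 0 ≤ L ∧ ∀ x y, ‖x‖ ≤ r → ‖y‖ ≤ r → ‖f x - f y‖ ≤ L * ‖x - y‖ := by
  obtain ⟨L, hL, hb⟩ := exists_norm_le_on_ball (hf.continuous_fderiv (by simp)) r
  refine ⟨L, hL, fun x y hx hy => ?_⟩
  exact (convex_closedBall (0 : E) r).norm_image_sub_le_of_norm_fderiv_le
    (fun z _ => hf.differentiable (by simp) z) (fun z hz => hb z (by simpa using hz))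
    (by simpa using hy) (by simpa using hx)

end Bounds

lemma norm_apply_le_of_inner_le {n : ℕ} {A : Mat n} {c : ℝ} (hc : 0 < c) (hA : IsSelfAdjoint A)
    (h0 : ∀ v, 0 ≤ ⟪v, A v⟫) (h : ∀ v, ⟪v, A v⟫ ≤ c * ‖v‖ ^ 2) (v : Vec n) :
    ‖A v‖ ≤ c * ‖v‖ := by
  -- positivity of the quadratic form at `v - c⁻¹ A v` gives `A² ≤ c A`
  have h1 := h0 (c • v - A v)
  have h2 : ⟪A v, A v⟫ = ⟪v, A (A v)⟫ := inner_apply_comm hA v (A v)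
  simp only [map_sub, map_smul, inner_sub_left, inner_sub_right, inner_smul_left,
    inner_smul_right, RCLike.conj_to_real, ← h2, real_inner_self_eq_norm_sq] at h1
  have h3 := h (A v)
  have h4 := h v
  have h5 : ‖A v‖ ^ 2 ≤ (c * ‖v‖) ^ 2 := by
    have h6 : c * ‖A v‖ ^ 2 ≤ c * (c * ⟪v, A v⟫) := by nlinarith
    have h7 := le_of_mul_le_mul_left h6 hc
    nlinarith
  exact le_of_sq_le_sq h5 (by positivity)

namespace Design
variable {n : ℕ} {d : Design n} {R : Robot n}

/-! ### From the error to the state -/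

/-- Norm bounds for the metric blocks and their inverses. -/
lemma Admissible.exists_norm_bounds (hd : d.Admissible R) : ∃ c : ℝ, 0 < c ∧
    (∀ q v, ‖R.Ml q v‖ ≤ c * ‖v‖) ∧ (∀ q v, ‖R.Mm q v‖ ≤ c * ‖v‖) ∧
    (∀ q v, ‖R.MlInv q v‖ ≤ c * ‖v‖) ∧
    (∀ z t v, 0 ≤ t → ‖(d.PiM z t).inverse v‖ ≤ c * ‖v‖) ∧
    (∀ z t v, 0 ≤ t → ‖d.PiL z t v‖ ≤ c * ‖v‖) := by
  obtain ⟨c₁, c₂, hc, hu⟩ := hd.uniform_metric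
  have hi : 0 < c₁⁻¹ := inv_pos.2 hc
  have hm1 : c₁⁻¹ ≤ max c₁⁻¹ c₂ := le_max_left _ _
  have hm2 : c₂ ≤ max c₁⁻¹ c₂ := le_max_right _ _
  have hm : 0 < max c₁⁻¹ c₂ := lt_of_lt_of_le hi hm1
  refine ⟨max c₁⁻¹ c₂, hm, fun q v => ?_, fun q v => ?_, fun q v => ?_, fun z t v ht => ?_,
    fun z t v ht => ?_⟩
  · have h := norm_le_of_inner_le hc ((hu (R.Ml q v)).2.2.1 q).1
    rw [R.MlInv_Ml] at h
    exact h.trans (by gcongr)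
  · have h := norm_le_of_inner_le hc ((hu (R.Mm q v)).2.2.2 q).1
    rw [R.MmInv_Mm] at h
    exact h.trans (by gcongr)
  · exact norm_apply_le_of_inner_le hm (R.isSelfAdjoint_MlInv q)
      (fun v => le_trans (by positivity) ((hu v).2.2.1 q).1)
      (fun v => ((hu v).2.2.1 q).2.trans (by gcongr)) v
  · have h := norm_le_of_inner_le hc ((hu ((d.PiM z t).inverse v)).2.1 z t ht).1
    rw [IsInvertible.apply_inverse (hd.isInvertible_PiM z ht)] at h
    exact h.trans (by gcongr)
  · exact norm_apply_le_of_inner_le hm (hd.selfAdjoint_PiL z t ht)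
      (fun v => le_trans (by positivity) ((hu v).1 z t ht).1)
      (fun v => ((hu v).1 z t ht).2.trans (by gcongr)) v

lemma norm_errL_le (d : Design n) (R : Robot n) (x : State n) (t : ℝ) :
    ‖d.errL x x t‖ ≤ ‖d.error R x t‖ :=
  (norm_fst_le (d.error R x t).1).trans (norm_fst_le _)

lemma norm_errM_le (d : Design n) (R : Robot n) (x : State n) (t : ℝ) :
    ‖d.errM R x x t‖ ≤ ‖d.error R x t‖ :=
  (norm_snd_le (d.error R x t).1).trans (norm_fst_le _)

lemma norm_sigmaL_le (d : Design n) (R : Robot n) (x : State n) (t : ℝ) :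
    ‖d.sigmaL R x x t‖ ≤ ‖d.error R x t‖ :=
  (norm_fst_le (d.error R x t).2).trans (norm_snd_le _)

lemma norm_sigmaM_le (d : Design n) (R : Robot n) (x : State n) (t : ℝ) :
    ‖d.sigmaM R x x t‖ ≤ ‖d.error R x t‖ :=
  (norm_snd_le (d.error R x t).2).trans (norm_snd_le _)

/-- Where the error is bounded, it dominates the distance to the steady state, because `φ_ℓ` and
`φ_m` vanish at zero and are Lipschitz on balls. -/
lemma Admissible.exists_norm_sub_xSteady_le (hd : d.Admissible R) (r : ℝ) (hr : 0 ≤ r) :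
    ∃ C : ℝ, 0 ≤ C ∧ ∀ (x : State n) (t : ℝ), 0 ≤ t → ‖d.error R x t‖ ≤ r →
      ‖x - d.xSteady R x t‖ ≤ C * ‖d.error R x t‖ := by
  obtain ⟨c, hc, hMl, hMm, hMli, hPi, -⟩ := hd.exists_norm_bounds
  obtain ⟨Ll, hLl, hφl⟩ := exists_lipschitz_on_ball hd.smooth_φl r
  obtain ⟨Lm, hLm, hφm⟩ := exists_lipschitz_on_ball hd.smooth_φm r
  set k := ‖ContinuousLinearMap.adjoint R.K‖ with hk
  have hk0 : 0 ≤ k := norm_nonneg _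
  refine ⟨1 + c * Ll + c * (Lm + c * (k * c)), by positivity, fun x t ht hx => ?_⟩
  set e := ‖d.error R x t‖ with he
  have he0 : 0 ≤ e := norm_nonneg _
  have h1 := norm_errL_le d R x t
  have h2 := norm_errM_le d R x t
  have h3 := norm_sigmaL_le d R x t
  have h4 := norm_sigmaM_le d R x t
  rw [← he] at h1 h2 h3 h4
  have hb1 : ‖R.Ml (ql x) (d.φl (d.errL x x t))‖ ≤ c * (Ll * e) := by
    have h := hφl (d.errL x x t) 0 (h1.trans hx) (by simpa using hr)
    rw [hd.φl_zero, sub_zero, sub_zero] at h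
    calc _ ≤ c * ‖d.φl (d.errL x x t)‖ := hMl _ _
      _ ≤ c * (Ll * ‖d.errL x x t‖) := by gcongr
      _ ≤ _ := by gcongr
  have hb2 : ‖d.φm (d.errM R x x t)‖ ≤ Lm * e := by
    have h := hφm (d.errM R x x t) 0 (h2.trans hx) (by simpa using hr)
    rw [hd.φm_zero, sub_zero, sub_zero] at h
    exact h.trans (by gcongr)
  have hb3 : ‖(d.PiM (d.errM R x x t) t).inverse
      (ContinuousLinearMap.adjoint R.K (R.MlInv (ql x) (d.sigmaL R x x t)))‖
      ≤ c * (k * (c * e)) := by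
    calc _ ≤ c * ‖ContinuousLinearMap.adjoint R.K (R.MlInv (ql x) (d.sigmaL R x x t))‖ :=
          hPi _ _ _ ht
      _ ≤ c * (k * ‖R.MlInv (ql x) (d.sigmaL R x x t)‖) := by
          gcongr; exact ContinuousLinearMap.le_opNorm _ _
      _ ≤ c * (k * (c * ‖d.sigmaL R x x t‖)) := by gcongr; exact hMli _ _
      _ ≤ _ := by gcongr
  have e3 : pl x - R.Ml (ql x) (deriv d.qld t) =
      d.sigmaL R x x t - R.Ml (ql x) (d.φl (d.errL x x t)) := by
    rw [sigmaL, plr, map_sub]; abel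
  have e4 : pm x - R.Mm (qm x) (R.totalDeriv (d.qmd R) x x t) =
      d.sigmaM R x x t - R.Mm (qm x) (d.φm (d.errM R x x t) +
        (d.PiM (d.errM R x x t) t).inverse
          (ContinuousLinearMap.adjoint R.K (R.MlInv (ql x) (d.sigmaL R x x t)))) := by
    rw [sigmaM, pmr]; simp only [map_sub, map_add]; abel
  have g3 : ‖pl x - R.Ml (ql x) (deriv d.qld t)‖ ≤ e + c * (Ll * e) := by
    rw [e3]
    exact (norm_sub_le _ _).trans (add_le_add h3 hb1)
  have g4 : ‖pm x - R.Mm (qm x) (R.totalDeriv (d.qmd R) x x t)‖ ≤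
      e + c * (Lm * e + c * (k * (c * e))) := by
    rw [e4]
    refine (norm_sub_le _ _).trans (add_le_add h4 ((hMm _ _).trans ?_))
    gcongr
    exact (norm_add_le _ _).trans (add_le_add hb2 hb3)
  have p1 : 0 ≤ c * (Ll * e) := by positivity
  have p2 : 0 ≤ c * (Lm * e + c * (k * (c * e))) := by positivity
  have hC : (1 + c * Ll + c * (Lm + c * (k * c))) * e =
      e + c * (Ll * e) + c * (Lm * e + c * (k * (c * e))) := by ring
  rw [hC]
  refine max_le (max_le ?_ ?_) (max_le ?_ ?_)
  · exact h1.trans (by linarith)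
  · exact h2.trans (by linarith)
  · exact g3.trans (by linarith)
  · exact g4.trans (by linarith)

/-! ### Boundedness of the motor reference -/

/-- The part of the link control law at `x_v = x` that does not involve the metric, as a function
of `(q_ℓ, p_ℓ, q_ℓd, q̇_ℓd, q̈_ℓd)`. -/
def linkLaw (d : Design n) (R : Robot n) (z : Vec n × Vec n × Vec n × Vec n × Vec n) : Vec n :=
  fderiv ℝ R.Ml z.1 (R.MlInv z.1 z.2.1) (z.2.2.2.1 - d.φl (z.1 - z.2.2.1))
    + R.Ml z.1 (z.2.2.2.2 - fderiv ℝ d.φl (z.1 - z.2.2.1) (R.MlInv z.1 z.2.1 - z.2.2.2.1))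
    + ∇ R.Pl z.1
    + (R.Sl z.1 z.2.1 - (1 / 2 : ℝ) • inertiaRate R.Ml z.1 z.2.1 + R.Dl z.1)
        (R.MlInv z.1 (R.Ml z.1 (z.2.2.2.1 - d.φl (z.1 - z.2.2.1))))
    - d.Kld (R.MlInv z.1 (z.2.1 - R.Ml z.1 (z.2.2.2.1 - d.φl (z.1 - z.2.2.1))))

lemma Admissible.contDiff_linkLaw (hd : d.Admissible R) : ContDiff ℝ ∞ (d.linkLaw R) := by
  have h1 : ContDiff ℝ ∞ (fderiv ℝ R.Ml) := R.smooth_Ml.fderiv_right (by simp)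
  have h2 : ContDiff ℝ ∞ (fderiv ℝ d.φl) := hd.smooth_φl.fderiv_right (by simp)
  have h3 := R.contDiff_MlInv
  have h4 := R.smooth_Ml
  have h5 := hd.smooth_φl
  have h6 := contDiff_gradient R.smooth_Pl
  have h7 := R.smooth_Dl
  have h8 : ContDiff ℝ ∞ (fun z : Vec n × Vec n × Vec n × Vec n × Vec n => R.Sl z.1 z.2.1) :=
    R.smooth_Sl.comp (f := fun z : Vec n × Vec n × Vec n × Vec n × Vec n => (z.1, z.2.1))
      (by fun_prop)
  have h9 : ContDiff ℝ ∞ (fun z : Vec n × Vec n × Vec n × Vec n × Vec n =>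
      inertiaRate R.Ml z.1 z.2.1) :=
    (Robot.contDiff_inertiaRate R.smooth_Ml R.contDiff_MlInv).comp
      (f := fun z : Vec n × Vec n × Vec n × Vec n × Vec n => (z.1, z.2.1)) (by fun_prop)
  unfold linkLaw
  fun_prop

/-- The argument of `linkLaw` at the state `x` and time `t`. -/
def linkData (d : Design n) (x : State n) (t : ℝ) : Vec n × Vec n × Vec n × Vec n × Vec n :=
  (ql x, pl x, d.qld t, deriv d.qld t, deriv (deriv d.qld) t)

lemma hasDerivAt_line (x v : State n) (t : ℝ) :
    HasDerivAt (fun s : ℝ => x + (s - t) • v) v t := by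
  simpa using (((hasDerivAt_id t).sub_const t).smul_const v).const_add x

/-- A total derivative on the diagonal can be computed along any curve that has the velocity of
the robot, and from its forward part only. -/
lemma totalDeriv_eq_of_hasDerivWithinAt {g : State n → State n → ℝ → Vec n}
    (hg : DependsOn withoutMotorMomenta g)
    (hdg : Differentiable ℝ (fun y : State n × State n × ℝ => g y.1 y.2.1 y.2.2))
    {x : State n} {t : ℝ} {g' : Vec n}
    (h : HasDerivWithinAt (fun s => g (x + (s - t) • R.field x 0) (x + (s - t) • R.field x 0) s)
      g' (Set.Ici t) t) : R.totalDeriv g x x t = g' := by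
  have hx : (x + (t - t) • R.field x 0) = x := by simp
  have h1 := (hasDerivAt_line x (R.field x 0) t).hasDerivWithinAt (s := Set.Ici t)
  have h2 := hg.hasDerivWithinAt R (x := fun s => x + (s - t) • R.field x 0) (u := 0)
    (hdg _) (h1.congr_deriv (by simp only [hx]))
  simp only [hx] at h2
  exact (uniqueDiffOn_Ici t t Set.self_mem_Ici).eq_deriv _ h2 h

lemma Admissible.totalDeriv_plr_eq (hd : d.Admissible R) (x : State n) (t : ℝ) :
    R.totalDeriv (d.plr R) x x t =
      fderiv ℝ R.Ml (ql x) (R.MlInv (ql x) (pl x)) (deriv d.qld t - d.φl (d.errL x x t))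
      + R.Ml (ql x) (deriv (deriv d.qld) t
        - fderiv ℝ d.φl (d.errL x x t) (R.MlInv (ql x) (pl x) - deriv d.qld t)) := by
  have hdep : DependsOn withoutMotorMomenta (d.plr R) :=
    (d.dependsOn_plr R).mono fun y y' h => by
      simp only [withoutMotorMomenta_apply, Prod.mk.injEq] at h
      simp only [linkPos_apply, h]
  refine totalDeriv_eq_of_hasDerivWithinAt hdep (hd.contDiff_plr.differentiable (by simp))
    (HasDerivAt.hasDerivWithinAt ?_)
  have hx : (x + (t - t) • R.field x 0) = x := by simp
  have h0 := hasDerivAt_line x (R.field x 0) t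
  have hv : (R.field x 0).1.1 = R.MlInv (ql x) (pl x) := by
    rw [R.field_eq, R.virtualField_eq]
  have hq : HasDerivAt (fun s => ql (x + (s - t) • R.field x 0)) (R.MlInv (ql x) (pl x)) t :=
    hv ▸ h0.fst.fst
  have hr := (hd.smooth_qld.differentiable (by simp) t).hasDerivAt
  have hr' := (hd.contDiff_deriv_qld.differentiable (by simp) t).hasDerivAt
  have he : HasDerivAt (fun s => ql (x + (s - t) • R.field x 0) - d.qld s)
      (R.MlInv (ql x) (pl x) - deriv d.qld t) t := hq.fun_sub hr
  have hM := (R.smooth_Ml.differentiable (by simp)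
    (ql (x + (t - t) • R.field x 0))).hasFDerivAt.comp_hasDerivAt t hq
  have hφ := (hd.smooth_φl.differentiable (by simp)
    (ql (x + (t - t) • R.field x 0) - d.qld t)).hasFDerivAt.comp_hasDerivAt t he
  have h := hM.clm_apply (hr'.fun_sub hφ)
  simp only [Function.comp_def, hx] at h
  exact h

/-- For `t ≥ 0` the link control law is `linkLaw` less the restoring force of the metric. -/
lemma Admissible.ul_eq (hd : d.Admissible R) (x : State n) {t : ℝ} (ht : 0 ≤ t) :
    d.ul R x x t = d.linkLaw R (d.linkData x t) - d.PiL 0 t (d.errL x x t) := by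
  rw [ul, hd.totalDeriv_plr_eq, metricIntegral_eq (fun z t ht => hd.PiL_eq z t ht) _ ht]
  simp only [linkLaw, linkData, Robot.El, sigmaL, plr, errL]
  abel

lemma Admissible.totalDeriv_qmd_eq (hd : d.Admissible R) (x : State n) {t : ℝ} (ht : 0 ≤ t) :
    R.totalDeriv (d.qmd R) x x t = (R.field x 0).1.1 + R.K.inverse
      (fderiv ℝ (d.linkLaw R) (d.linkData x t)
        ((R.field x 0).1.1, (R.field x 0).2.1, deriv d.qld t, deriv (deriv d.qld) t,
          deriv (deriv (deriv d.qld)) t)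
      - (deriv (fun s => d.PiL 0 s) t (d.errL x x t)
        + d.PiL 0 t ((R.field x 0).1.1 - deriv d.qld t))) := by
  have hdep : DependsOn withoutMotorMomenta (d.qmd R) :=
    hd.dependsOn_qmd.mono fun y y' h => by
      simp only [withoutMotorMomenta_apply, Prod.mk.injEq] at h
      simp only [linkState_apply, h]
  refine totalDeriv_eq_of_hasDerivWithinAt hdep (hd.contDiff_qmd.differentiable (by simp)) ?_
  have hx : (x + (t - t) • R.field x 0) = x := by simp
  have h0 := hasDerivAt_line x (R.field x 0) t
  have hq : HasDerivAt (fun s => ql (x + (s - t) • R.field x 0)) (R.field x 0).1.1 t := h0.fst.fst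
  have hp : HasDerivAt (fun s => pl (x + (s - t) • R.field x 0)) (R.field x 0).2.1 t := h0.snd.fst
  have hr := (hd.smooth_qld.differentiable (by simp) t).hasDerivAt
  have hr' := (hd.contDiff_deriv_qld.differentiable (by simp) t).hasDerivAt
  have hr'' := (((contDiff_infty_iff_deriv.1 hd.contDiff_deriv_qld).2).differentiable
    (by simp) t).hasDerivAt
  have hN := (hasDerivAt_metric hd.smooth_PiL 0 t).differentiableAt.hasDerivAt
  have he : HasDerivAt (fun s => ql (x + (s - t) • R.field x 0) - d.qld s)
      ((R.field x 0).1.1 - deriv d.qld t) t := hq.fun_sub hr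
  have hz : HasDerivAt (fun s => d.linkData (x + (s - t) • R.field x 0) s)
      ((R.field x 0).1.1, (R.field x 0).2.1, deriv d.qld t, deriv (deriv d.qld) t,
          deriv (deriv (deriv d.qld)) t) t :=
    hq.prodMk (hp.prodMk (hr.prodMk (hr'.prodMk hr'')))
  have hG := (hd.contDiff_linkLaw.differentiable (by simp)
    (d.linkData (x + (t - t) • R.field x 0) t)).hasFDerivAt.comp_hasDerivAt t
      (f := fun s => d.linkData (x + (s - t) • R.field x 0) s) hz
  have hu := hG.fun_sub (hN.clm_apply he)
  have h := hq.fun_add (R.K.inverse.hasFDerivAt.comp_hasDerivAt t hu)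
  simp only [Function.comp_def, hx] at h
  refine (h.hasDerivWithinAt (s := Set.Ici t)).congr_of_mem (fun s hs => ?_) Set.self_mem_Ici
  rw [qmd, hd.ul_eq _ (ht.trans hs)]
  rfl

/-- Where the error is bounded, a bounded reference keeps the positions and the motor reference
with its velocity bounded. The motor momentum is not bounded beforehand: the link velocity and
force do not involve it. -/
lemma Admissible.exists_bounds (hd : d.Admissible R) (hb : d.BoundedReference) (r : ℝ) :
    ∃ B : ℝ, 0 ≤ B ∧ ∀ (x : State n) (t : ℝ), 0 ≤ t → ‖d.error R x t‖ ≤ r →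
      ‖ql x‖ ≤ B ∧ ‖qm x‖ ≤ B ∧ ‖d.qld t‖ ≤ B ∧ ‖deriv d.qld t‖ ≤ B ∧
      ‖d.qmd R x x t‖ ≤ B ∧ ‖R.totalDeriv (d.qmd R) x x t‖ ≤ B := by
  obtain ⟨b, hb⟩ := hb
  have hb0 : 0 ≤ b := (norm_nonneg _).trans ((hb 0 le_rfl).2 0)
  have r0 : ∀ t, 0 ≤ t → ‖d.qld t‖ ≤ b := fun t ht => by
    simpa using (hb t ht).1 0 (by norm_num)
  have r1 : ∀ t, 0 ≤ t → ‖deriv d.qld t‖ ≤ b := fun t ht => by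
    simpa using (hb t ht).1 1 (by norm_num)
  have r2 : ∀ t, 0 ≤ t → ‖deriv (deriv d.qld) t‖ ≤ b := fun t ht => by
    simpa [iteratedDeriv_succ] using (hb t ht).1 2 (by norm_num)
  have r3 : ∀ t, 0 ≤ t → ‖deriv (deriv (deriv d.qld)) t‖ ≤ b := fun t ht => by
    simpa [iteratedDeriv_succ] using (hb t ht).1 3 (by norm_num)
  have rN : ∀ t, 0 ≤ t → ‖deriv (fun s => d.PiL 0 s) t‖ ≤ b := fun t ht => (hb t ht).2 0
  obtain ⟨c, hc, hMl, -, -, -, hPi⟩ := hd.exists_norm_bounds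
  obtain ⟨Bφ, hBφ, hφ⟩ := exists_norm_le_on_ball hd.smooth_φl.continuous r
  rcases lt_or_ge r 0 with hr | hr
  · exact ⟨0, le_rfl, fun x t _ hx => absurd ((norm_nonneg _).trans hx) (not_le.2 hr)⟩
  -- bounds for the link state, the motor reference, the motor position and the velocities
  set bq := r + b with hbq
  set bp := r + c * (b + Bφ) with hbp
  set bz := bq + bp + b with hbz
  have hbq0 : 0 ≤ bq := by positivity
  have hbp0 : 0 ≤ bp := by positivity
  have hbz0 : 0 ≤ bz := by positivity
  obtain ⟨BG, hBG, hG⟩ := exists_norm_le_on_ball hd.contDiff_linkLaw.continuous bz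
  obtain ⟨BG', hBG', hG'⟩ := exists_norm_le_on_ball
    (hd.contDiff_linkLaw.continuous_fderiv (by simp)) bz
  set k := ‖R.K.inverse‖ with hk
  have hk0 : 0 ≤ k := norm_nonneg _
  set bd := bq + k * (BG + c * r) with hbd
  set bm := r + bd with hbm
  have hbd0 : 0 ≤ bd := by positivity
  have hbm0 : 0 ≤ bm := by positivity
  obtain ⟨Bf, hBf, hf⟩ := exists_norm_le_on_ball R.contDiff_field.continuous (bq + bm + bp)
  set bv := Bf + k * (BG' * (Bf + b) + (b * r + c * (Bf + b))) with hbv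
  have hbv0 : 0 ≤ bv := by positivity
  refine ⟨bq + bm + b + bd + bv, by positivity, fun x t ht hx => ?_⟩
  have hel := (norm_errL_le d R x t).trans hx
  have hem := (norm_errM_le d R x t).trans hx
  have hsl := (norm_sigmaL_le d R x t).trans hx
  have hq : ‖ql x‖ ≤ bq := by
    have h : ql x = d.errL x x t + d.qld t := by rw [errL]; abel
    rw [h]
    exact (norm_add_le _ _).trans (add_le_add hel (r0 t ht))
  have hp : ‖pl x‖ ≤ bp := by
    have h : pl x = d.sigmaL R x x t + d.plr R x x t := by rw [sigmaL]; abel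
    rw [h]
    refine (norm_add_le _ _).trans (add_le_add hsl ((hMl _ _).trans ?_))
    gcongr
    exact (norm_sub_le _ _).trans (add_le_add (r1 t ht) (hφ _ hel))
  have hz : ‖d.linkData x t‖ ≤ bz := by
    refine max_le ?_ (max_le ?_ (max_le ?_ (max_le ?_ ?_)))
    · change ‖ql x‖ ≤ _; linarith
    · change ‖pl x‖ ≤ _; linarith
    · have := r0 t ht; change ‖d.qld t‖ ≤ _; linarith
    · have := r1 t ht; change ‖deriv d.qld t‖ ≤ _; linarith
    · have := r2 t ht; change ‖deriv (deriv d.qld) t‖ ≤ _; linarith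
  have hqmd : ‖d.qmd R x x t‖ ≤ bd := by
    rw [qmd, hd.ul_eq x ht]
    refine (norm_add_le _ _).trans (add_le_add hq ((R.K.inverse.le_opNorm _).trans ?_))
    gcongr
    refine (norm_sub_le _ _).trans (add_le_add (hG _ hz) ((hPi _ _ _ ht).trans ?_))
    gcongr
  have hqm : ‖qm x‖ ≤ bm := by
    have h : qm x = d.errM R x x t + d.qmd R x x t := by rw [errM]; abel
    rw [h]
    exact (norm_add_le _ _).trans (add_le_add hem hqmd)
  have hy : ‖(((ql x, qm x), (pl x, 0)) : State n)‖ ≤ bq + bm + bp := by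
    refine max_le (max_le ?_ ?_) (max_le ?_ ?_)
    · change ‖ql x‖ ≤ _; linarith
    · change ‖qm x‖ ≤ _; linarith
    · change ‖pl x‖ ≤ _; linarith
    · change ‖(0 : Vec n)‖ ≤ _; rw [norm_zero]; positivity
  have hfy := hf _ hy
  have hf1 : ‖(R.field x 0).1.1‖ ≤ Bf := by
    have h : (R.field x 0).1.1 = (R.field ((ql x, qm x), (pl x, 0)) 0).1.1 := by
      rw [R.field_eq, R.field_eq, R.virtualField_eq, R.virtualField_eq]; rfl
    rw [h]
    exact (norm_fst_le _).trans ((norm_fst_le _).trans hfy)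
  have hf2 : ‖(R.field x 0).2.1‖ ≤ Bf := by
    have h : (R.field x 0).2.1 = (R.field ((ql x, qm x), (pl x, 0)) 0).2.1 := by
      rw [R.field_eq, R.field_eq, R.virtualField_eq, R.virtualField_eq]; rfl
    rw [h]
    exact (norm_fst_le _).trans ((norm_snd_le _).trans hfy)
  have hv : ‖R.totalDeriv (d.qmd R) x x t‖ ≤ bv := by
    rw [hd.totalDeriv_qmd_eq x ht]
    refine (norm_add_le _ _).trans (add_le_add hf1 ((R.K.inverse.le_opNorm _).trans ?_))
    gcongr
    refine (norm_sub_le _ _).trans (add_le_add ?_ ((norm_add_le _ _).trans (add_le_add ?_ ?_)))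
    · refine (ContinuousLinearMap.le_opNorm _ _).trans ?_
      refine mul_le_mul (hG' _ hz) ?_ (norm_nonneg _) hBG'
      refine max_le ?_ (max_le ?_ (max_le ?_ (max_le ?_ ?_)))
      · change ‖(R.field x 0).1.1‖ ≤ _; linarith
      · change ‖(R.field x 0).2.1‖ ≤ _; linarith
      · have := r1 t ht; change ‖deriv d.qld t‖ ≤ _; linarith
      · have := r2 t ht; change ‖deriv (deriv d.qld) t‖ ≤ _; linarith
      · have := r3 t ht; change ‖deriv (deriv (deriv d.qld)) t‖ ≤ _; linarith
    · refine (ContinuousLinearMap.le_opNorm _ _).trans ?_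
      exact mul_le_mul (rN t ht) hel (norm_nonneg _) hb0
    · refine (hPi _ _ _ ht).trans ?_
      gcongr
      exact (norm_sub_le _ _).trans (add_le_add hf1 (r1 t ht))
  have := r0 t ht
  have := r1 t ht
  refine ⟨?_, ?_, ?_, ?_, ?_, ?_⟩ <;> linarith

/-- With a bounded reference, the inertia matrices at `q` and `q_d` differ by a multiple of the
error, so that the error dominates the distance from the steady state to the desired trajectory. -/
lemma Admissible.exists_norm_xSteady_sub_xDesired_le (hd : d.Admissible R)
    (hb : d.BoundedReference) (r : ℝ) :
    ∃ C : ℝ, 0 ≤ C ∧ ∀ (x : State n) (t : ℝ), 0 ≤ t → ‖d.error R x t‖ ≤ r →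
      ‖d.xSteady R x t - d.xDesired R x t‖ ≤ C * ‖d.error R x t‖ := by
  obtain ⟨B, hB, hbd⟩ := hd.exists_bounds hb r
  obtain ⟨Ll, hLl, hl⟩ := exists_lipschitz_on_ball R.smooth_Ml B
  obtain ⟨Lm, hLm, hm⟩ := exists_lipschitz_on_ball R.smooth_Mm B
  refine ⟨Ll * B + Lm * B, by positivity, fun x t ht hx => ?_⟩
  obtain ⟨h1, h2, h3, h4, h5, h6⟩ := hbd x t ht hx
  have hel := norm_errL_le d R x t
  have hem := norm_errM_le d R x t
  set e := ‖d.error R x t‖ with he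
  have he0 : 0 ≤ e := norm_nonneg _
  have g1 : ‖R.Ml (ql x) (deriv d.qld t) - R.Ml (d.qld t) (deriv d.qld t)‖ ≤ Ll * e * B := by
    rw [← sub_apply]
    refine (ContinuousLinearMap.le_opNorm _ _).trans ?_
    refine mul_le_mul ((hl _ _ h1 h3).trans ?_) h4 (norm_nonneg _) (by positivity)
    gcongr
    exact hel
  have g2 : ‖R.Mm (qm x) (R.totalDeriv (d.qmd R) x x t) -
      R.Mm (d.qmd R x x t) (R.totalDeriv (d.qmd R) x x t)‖ ≤ Lm * e * B := by
    rw [← sub_apply]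
    refine (ContinuousLinearMap.le_opNorm _ _).trans ?_
    refine mul_le_mul ((hm _ _ h2 h5).trans ?_) h6 (norm_nonneg _) (by positivity)
    gcongr
    exact hem
  have p1 : 0 ≤ Ll * e * B := by positivity
  have p2 : 0 ≤ Lm * e * B := by positivity
  have hC : (Ll * B + Lm * B) * e = Ll * e * B + Lm * e * B := by ring
  rw [hC]
  refine max_le ?_ (max_le ?_ ?_)
  · change ‖d.qDesired R x t - d.qDesired R x t‖ ≤ _
    rw [sub_self, norm_zero]
    linarith
  · exact g1.trans (by linarith)
  · exact g2.trans (by linarith)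

end Design

end FlexibleJoint

end

theorem mainTheorem2 (n : ℕ) (hn : 0 < n) (R : FlexibleJoint.Robot n)
    (d : FlexibleJoint.Design n) (hd : d.Admissible R) :
    0 < d.rate R ∧
    (∃ C : ℝ, ∀ (t₀ : ℝ) (J : Set ℝ) (x : ℝ → FlexibleJoint.State n),
      0 ≤ t₀ → t₀ ∈ J → J ⊆ Set.Ici t₀ → J.OrdConnected → d.IsClosedLoopSolution R J x →
      ∀ t ∈ J, ‖d.error R (x t) t‖ ≤
        C * Real.exp (-(d.rate R) * (t - t₀)) * ‖d.error R (x t₀) t₀‖) ∧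
    (∀ (t₀ : ℝ) (x₀ : FlexibleJoint.State n), 0 ≤ t₀ →
      ∃ C : ℝ, ∀ (J : Set ℝ) (x : ℝ → FlexibleJoint.State n),
        t₀ ∈ J → J ⊆ Set.Ici t₀ → J.OrdConnected → d.IsClosedLoopSolution R J x → x t₀ = x₀ →
        ∀ t ∈ J, ‖x t - d.xSteady R (x t) t‖ ≤ C * Real.exp (-(d.rate R) * (t - t₀))) ∧
    (d.BoundedReference → ∀ (t₀ : ℝ) (x₀ : FlexibleJoint.State n), 0 ≤ t₀ →
      ∃ C : ℝ, ∀ (J : Set ℝ) (x : ℝ → FlexibleJoint.State n),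
        t₀ ∈ J → J ⊆ Set.Ici t₀ → J.OrdConnected → d.IsClosedLoopSolution R J x → x t₀ = x₀ →
        ∀ t ∈ J, ‖x t - d.xDesired R (x t) t‖ ≤ C * Real.exp (-(d.rate R) * (t - t₀))) := by
  have hrate := hd.rate_pos hn
  obtain ⟨C, hC, hdecay⟩ := hd.exists_norm_error_le hn
  -- since the rate is positive, the error of a solution also stays in a fixed ball
  have hball : ∀ (t₀ t : ℝ) (e e₀ : ℝ), 0 ≤ e₀ → t₀ ≤ t →
      e ≤ C * Real.exp (-(d.rate R) * (t - t₀)) * e₀ → e ≤ C * e₀ := by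
    intro t₀ t e e₀ he₀ htt he
    refine he.trans ?_
    have h : Real.exp (-(d.rate R) * (t - t₀)) ≤ 1 := by
      rw [Real.exp_le_one_iff]
      nlinarith
    gcongr
    exact mul_le_of_le_one_right hC h
  refine ⟨hrate, ⟨C, hdecay⟩, fun t₀ x₀ ht₀ => ?_, fun hb t₀ x₀ ht₀ => ?_⟩
  · set e₀ := ‖d.error R x₀ t₀‖ with he₀
    have he₀' : 0 ≤ e₀ := norm_nonneg _
    obtain ⟨A, hA, hbound⟩ := hd.exists_norm_sub_xSteady_le (C * e₀) (by positivity)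
    refine ⟨A * C * e₀, fun J x hmem hsub hord hsol hx₀ t ht => ?_⟩
    have h := hdecay t₀ J x ht₀ hmem hsub hord hsol t ht
    rw [hx₀, ← he₀] at h
    have htt : t₀ ≤ t := hsub ht
    refine (hbound (x t) t (ht₀.trans htt) (hball t₀ t _ e₀ he₀' htt h)).trans ?_
    calc _ ≤ A * (C * Real.exp (-(d.rate R) * (t - t₀)) * e₀) := by gcongr
      _ = _ := by ring
  · set e₀ := ‖d.error R x₀ t₀‖ with he₀
    have he₀' : 0 ≤ e₀ := norm_nonneg _
    obtain ⟨A, hA, hbound⟩ := hd.exists_norm_sub_xSteady_le (C * e₀) (by positivity)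
    obtain ⟨A', hA', hbound'⟩ := hd.exists_norm_xSteady_sub_xDesired_le hb (C * e₀)
    refine ⟨(A + A') * C * e₀, fun J x hmem hsub hord hsol hx₀ t ht => ?_⟩
    have h := hdecay t₀ J x ht₀ hmem hsub hord hsol t ht
    rw [hx₀, ← he₀] at h
    have htt : t₀ ≤ t := hsub ht
    have hin := hball t₀ t _ e₀ he₀' htt h
    have h1 := hbound (x t) t (ht₀.trans htt) hin
    have h2 := hbound' (x t) t (ht₀.trans htt) hin
    calc ‖x t - d.xDesired R (x t) t‖
        ≤ ‖x t - d.xSteady R (x t) t‖ + ‖d.xSteady R (x t) t - d.xDesired R (x t) t‖ :=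
          norm_sub_le_norm_sub_add_norm_sub _ _ _
      _ ≤ (A + A') * ‖d.error R (x t) t‖ := by rw [add_mul]; exact add_le_add h1 h2
      _ ≤ (A + A') * (C * Real.exp (-(d.rate R) * (t - t₀)) * e₀) := by gcongr
      _ = _ := by ring
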